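/- **Setting.** Let $G$ be a finite connected directed graph without loops, parallel or antiparallel arcs, with vertex set $V$ and arc set $A$; let $T\ge 1$ be an integer and $\ell,u\in\mathbb R^{A}$ with $0\le \ell_a<T$ and $0<u_a-\ell_a<T$ for all $a\in A$ (a PESP instance). Let $B$ be the incidence matrix of $G$ ($+1$ at the tail and $-1$ at the head of an arc). An oriented cycle is a vector $\gamma\in\{-1,0,1\}^A$ with $B\gamma=0$; the oriented cycles generate the cycle space of $G$, a subgroup of $\mathbb Z^A$, of rank $\mu$. Let $\Gamma\in\mathbb Z^{\mu\times A}$ be the cycle matrix of an integral cycle basis, i.e. its $\mu$ rows are oriented cycles that generate the cycle space over $\mathbb Z$. Put $$Z=\{z\in\mathbb R^\mu\mid \exists x\in\mathbb R^A:\ \Gamma x=Tz,\ \ell\le x\le u\},$$ and let $\Gamma'$ arise from $\Gamma$ by multiplying the column of each arc $a$ by $(u_a-\ell_a)/T$. Then $Z$ is a translate of the zonotope $Z(\Gamma')=\{\Gamma' x\mid 0\le x\le 1\}$. *Fine zonotopal tilings.* For $S\subseteq A$ let $\Gamma'_S$ be $\Gamma'$ with the columns in $S$ deleted. A zonotopal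 tiling of $Z$ is a polyhedral subdivision of $Z$ whose cells are translates of zonotopes $Z(\Gamma'_S)$; its tiles are its maximal cells. It is fine if one can assign to each tile $C$ a set $S_C\subseteq A$ such that $C$ is a translate of $Z(\Gamma'_{S_C})$, the columns of $\Gamma'_{S_C}$ are linearly independent, and $S_C\ne S_D$ for different tiles $C\neq D$. *Spanning tree structures.* These are triples $(S,L,U)$ of subsets of $A$ with $S=L\cup U$, $L\cap U=\varnothing$, such that $S$ is the arc set of a spanning tree of $G$. Let $$\mathcal F_{L,U}=\{x\in\mathbb R^A\mid \ell\le x\le u,\ x_a=\ell_a\ (a\in L),\ x_a=u_a\ (a\in U)\}.$$ *Polytropes.* For $p\in\mathbb Z^A$ let $$R(p)=\{\pi\in\mathbb R^V\mid \ell_{ij}-Tp_{ij}\le\pi_j-\pi_i\le u_{ij}-Tp_{ij}\ \text{ for all } (i,j)\in A\}.$$ For $z\in\mathbb Z^\mu$ let $\mathfrak R(z)$ be the image of $R(p)$ in the torus $\mathscr T=(\mathbb R^V/(T\mathbb Z)^V)/\mathbb R\mathbf 1$ for any $p$ with $\Gamma p=z$; it does not depend on the choice of $p$. Its vertices are the images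 of the vertices of $R(p)/\mathbb R\mathbf 1$. A vertex of $\mathfrak R(z)$ is defined by $(S,L,U)$ if it is the unique point of $\mathfrak R(z)$, represented by $\pi\in R(p)$, $\Gamma p=z$, whose tension $-B^\top\pi+Tp$ lies in $\mathcal F_{L,U}$. **Theorem.** Fix an arbitrary fine zonotopal tiling of $Z$ and let $C$ be a tile. Then $C$ is the image of $\mathcal F_{L,U}$ under $\frac1T\Gamma$ for a spanning tree structure $(S,L,U)$. Moreover, for every spanning tree structure $(S,L,U)$ such that $C$ is the image of $\mathcal F_{L,U}$ under $\frac1T\Gamma$, and every integer point $z\in\mathbb Z^\mu\cap C$, the polytrope $\mathfrak R(z)$ has a vertex defined by $(S,L,U)$. -/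

import Mathlib

open scoped Matrix

noncomputable section

/-! Digraphs, cycle spaces and integral cycle bases -/

/-- The arcs of a digraph. -/
abbrev Digraph.Arc {V : Type*} (G : Digraph V) : Type _ := {a : V × V // G.Adj a.1 a.2}

namespace Digraph

variable {V : Type*} (G : Digraph V)

instance instFintypeArc [Fintype V] : Fintype G.Arc := Fintype.ofFinite _

/-- The tail `i` of an arc `(i, j)`. -/
def src {G : Digraph V} (a : G.Arc) : V := a.1.1

/-- The head `j` of an arc `(i, j)`. -/
def tgt {G : Digraph V} (a : G.Arc) : V := a.1.2

/-- The undirected graph on all vertices of `G` whose edges underlie the arcs in `S`. -/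
def spanningSubgraph (S : Set G.Arc) : SimpleGraph V :=
  SimpleGraph.fromRel fun i j => ∃ h : G.Adj i j, (⟨(i, j), h⟩ : G.Arc) ∈ S

/-- The incidence matrix: `+1` at the tail and `-1` at the head of an arc. -/
def incidence [DecidableEq V] : Matrix V G.Arc ℤ :=
  Matrix.of fun v a => (if src a = v then 1 else 0) - (if tgt a = v then 1 else 0)

variable [Fintype V] [DecidableEq V]

/-- Oriented cycles: vectors `γ` with entries in `{-1, 0, 1}` and `B γ = 0`. -/
def IsOrientedCycle (γ : G.Arc → ℤ) : Prop :=
  (∀ a, γ a = -1 ∨ γ a = 0 ∨ γ a = 1) ∧ G.incidence *ᵥ γ = 0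

/-- The cycle space: the subgroup of `ℤ^A` generated by the oriented cycles. -/
def cycleSpace : Submodule ℤ (G.Arc → ℤ) := Submodule.span ℤ {γ | G.IsOrientedCycle γ}

/-- The cyclomatic number: the rank of the cycle space. -/
def cyclomaticNumber : ℕ := Module.finrank ℤ G.cycleSpace

/-- `Γ` is the cycle matrix of an integral cycle basis: it has `μ` rows, these are oriented cycles,
and they generate the cycle space over `ℤ`. -/
structure IsIntegralCycleMatrix {𝓑 : Type*} [Fintype 𝓑] (Γ : Matrix 𝓑 G.Arc ℤ) : Prop where
  card_eq : Fintype.card 𝓑 = G.cyclomaticNumber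
  isOrientedCycle : ∀ i, G.IsOrientedCycle (Γ i)
  span_eq : Submodule.span ℤ (Set.range Γ) = G.cycleSpace

end Digraph

/-! Zonotopes and fine zonotopal tilings -/

section Zonotope

variable {κ ι : Type*}

/-- The zonotope `Z(A, b) = {A x + b | 0 ≤ x ≤ 1}`. -/
def zonotope [Fintype ι] (A : Matrix κ ι ℝ) (b : κ → ℝ) : Set (κ → ℝ) :=
  {y | ∃ x : ι → ℝ, (∀ i, 0 ≤ x i ∧ x i ≤ 1) ∧ y = A *ᵥ x + b}

/-- `A_S`: the submatrix of `A` obtained by deleting the columns indexed by `S`. -/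
def deleteCols (A : Matrix κ ι ℝ) (S : Set ι) : Matrix κ {i // i ∉ S} ℝ :=
  A.submatrix id Subtype.val

open Classical in
/-- `C` is a translate of `Z(A_S)`. -/
def IsTranslateOfSubzonotope [Fintype ι] (A : Matrix κ ι ℝ) (S : Set ι) (C : Set (κ → ℝ)) : Prop :=
  ∃ b : κ → ℝ, C = zonotope (deleteCols A S) b

/-- `𝒞` is (the set of nonempty cells of) a polyhedral subdivision of `P`: finitely many nonempty
polytopes with union `P`, containing with each cell all its nonempty faces, and such that any two
cells meet in a (possibly empty) common face.  Faces are exposed faces, which for polytopes are all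
faces. -/
structure IsPolyhedralSubdivision (P : Set (κ → ℝ)) (𝒞 : Set (Set (κ → ℝ))) : Prop where
  finite : 𝒞.Finite
  nonempty : ∀ C ∈ 𝒞, C.Nonempty
  polytope : ∀ C ∈ 𝒞, ∃ s : Finset (κ → ℝ), C = convexHull ℝ (s : Set (κ → ℝ))
  sUnion_eq : ⋃₀ 𝒞 = P
  face_mem : ∀ C ∈ 𝒞, ∀ F, F.Nonempty → IsExposed ℝ C F → F ∈ 𝒞
  inter_face : ∀ C ∈ 𝒞, ∀ D ∈ 𝒞, IsExposed ℝ C (C ∩ D)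

/-- The tiles of a subdivision are its maximal cells. -/
def IsTile (𝒞 : Set (Set (κ → ℝ))) (C : Set (κ → ℝ)) : Prop := Maximal (· ∈ 𝒞) C

/-- A zonotopal tiling of `P`, a translate of `Z(A)`: a polyhedral subdivision all of whose cells
are translates of zonotopes `Z(A_S)`. -/
structure IsZonotopalTiling [Fintype ι] (A : Matrix κ ι ℝ) (P : Set (κ → ℝ))
    (𝒞 : Set (Set (κ → ℝ))) : Prop extends IsPolyhedralSubdivision P 𝒞 where
  cell : ∀ C ∈ 𝒞, ∃ S : Set ι, IsTranslateOfSubzonotope A S C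

/-- A fine zonotopal tiling: each tile `C` is a translate of some `Z(A_S)`, `S = σ C`, with linearly
independent generators, and no subset of the columns of `A` is used for two different tiles. -/
structure IsFineZonotopalTiling [Fintype ι] (A : Matrix κ ι ℝ) (P : Set (κ → ℝ))
    (𝒞 : Set (Set (κ → ℝ))) : Prop extends IsZonotopalTiling A P 𝒞 where
  fine : ∃ σ : Set (κ → ℝ) → Set ι,
    (∀ C, IsTile 𝒞 C → IsTranslateOfSubzonotope A (σ C) C ∧
      LinearIndependent ℝ (deleteCols A (σ C)).col) ∧
    (∀ C D, IsTile 𝒞 C → IsTile 𝒞 D → σ C = σ D → C = D)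

end Zonotope

/-! Instances of the Periodic Event Scheduling Problem -/

/-- A PESP instance `(G, T, l, u, w)`. -/
structure PESPInstance (V : Type*) where
  G : Digraph V
  T : ℕ
  l : G.Arc → ℝ
  u : G.Arc → ℝ
  w : G.Arc → ℝ

namespace PESPInstance

open Digraph

variable {V : Type*} (I : PESPInstance V)

/-- The standing assumptions: `G` has no loops and no antiparallel arcs and is connected, and
`0 ≤ l < T`, `0 < u - l < T`. -/
structure Standard : Prop where
  loopless : ∀ i, ¬ I.G.Adj i i
  not_antiparallel : ∀ i j, I.G.Adj i j → ¬ I.G.Adj j i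
  connected : (I.G.spanningSubgraph Set.univ).Connected
  T_pos : 0 < I.T
  l_nonneg : ∀ a, 0 ≤ I.l a
  l_lt : ∀ a, I.l a < I.T
  l_lt_u : ∀ a, I.l a < I.u a
  span_lt : ∀ a, I.u a - I.l a < I.T

/-- `(S, L, U)` is a spanning tree structure. -/
structure IsSpanningTreeStructure (S L U : Set I.G.Arc) : Prop where
  eq_union : S = L ∪ U
  disjoint : Disjoint L U
  isTree : (I.G.spanningSubgraph S).IsTree

/-- The face `𝓕_{L,U}` of the box `{x | l ≤ x ≤ u}`. -/
def boxFace (L U : Set I.G.Arc) : Set (I.G.Arc → ℝ) :=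
  {x | (∀ a, I.l a ≤ x a ∧ x a ≤ I.u a) ∧ (∀ a ∈ L, x a = I.l a) ∧ (∀ a ∈ U, x a = I.u a)}

/-- The vector `-Bᵀ π + T p`. -/
def tension (p : I.G.Arc → ℤ) (π : V → ℝ) (a : I.G.Arc) : ℝ :=
  π (tgt a) - π (src a) + I.T * p a

/-- The polyhedron `R(p)`. -/
def R (p : I.G.Arc → ℤ) : Set (V → ℝ) :=
  {π | ∀ a : I.G.Arc, I.l a - I.T * p a ≤ π (tgt a) - π (src a) ∧
    π (tgt a) - π (src a) ≤ I.u a - I.T * p a}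

/-- The line `ℝ𝟏` in `ℝ^V`. -/
def onesLine (V : Type*) : Submodule ℝ (V → ℝ) := Submodule.span ℝ {1}

/-- `R(p)/ℝ𝟏` as a subset of the vector space `ℝ^V/ℝ𝟏`. -/
def RModOnes (p : I.G.Arc → ℤ) : Set ((V → ℝ) ⧸ onesLine V) :=
  (onesLine V).mkQ '' I.R p

/-- The subgroup `(Tℤ)^V` of `ℝ^V`. -/
def periodLattice : AddSubgroup (V → ℝ) where
  carrier := {π | ∃ q : V → ℤ, ∀ v, π v = I.T * q v}
  zero_mem' := ⟨0, by simp⟩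
  add_mem' := by
    rintro _ _ ⟨q, hq⟩ ⟨r, hr⟩
    exact ⟨q + r, fun v => by simp [hq v, hr v, mul_add]⟩
  neg_mem' := by
    rintro _ ⟨q, hq⟩
    exact ⟨-q, fun v => by simp [hq v]⟩

/-- The torus `𝒯 = (ℝ^V/(Tℤ)^V)/ℝ𝟏`, as the quotient of `ℝ^V` by `(Tℤ)^V + ℝ𝟏`. -/
abbrev Torus : Type _ := (V → ℝ) ⧸ (I.periodLattice ⊔ (onesLine V).toAddSubgroup)

/-- The projection `ℝ^V → 𝒯`. -/
def toTorus (π : V → ℝ) : I.Torus := QuotientAddGroup.mk π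

variable [Fintype V] {𝓑 : Type*} (Γ : Matrix 𝓑 I.G.Arc ℤ)

/-- The map `x ↦ Γ x / T`. -/
def cycleOffsetMap (x : I.G.Arc → ℝ) : 𝓑 → ℝ :=
  (1 / (I.T : ℝ)) • (Γ.map (Int.cast : ℤ → ℝ) *ᵥ x)

/-- The cycle offset zonotope. -/
def cycleOffsetZonotope : Set (𝓑 → ℝ) :=
  {z | ∃ x : I.G.Arc → ℝ, Γ.map (Int.cast : ℤ → ℝ) *ᵥ x = (I.T : ℝ) • z ∧
    ∀ a, I.l a ≤ x a ∧ x a ≤ I.u a}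

/-- The generator matrix `Γ'` of the cycle offset zonotope: the column of `Γ` at the arc `a` is
multiplied by `(u a - l a) / T`. -/
def scaledCycleMatrix : Matrix 𝓑 I.G.Arc ℝ :=
  Matrix.of fun b a => (Γ b a : ℝ) * ((I.u a - I.l a) / I.T)

theorem cycleOffsetZonotope_eq (h : I.Standard) :
    I.cycleOffsetZonotope Γ = zonotope (I.scaledCycleMatrix Γ) (I.cycleOffsetMap Γ I.l) := by
  have hT : (I.T : ℝ) ≠ 0 := by exact_mod_cast h.T_pos.ne'
  ext z
  constructor
  · rintro ⟨x, hx, hb⟩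
    refine ⟨fun a => (x a - I.l a) / (I.u a - I.l a), fun a => ?_, ?_⟩
    · have := sub_pos.2 (h.l_lt_u a)
      exact ⟨div_nonneg (by linarith [(hb a).1]) this.le,
        (div_le_one this).2 (by linarith [(hb a).2])⟩
    · ext b
      have hb' := congrFun hx b
      simp only [Matrix.mulVec, dotProduct, Matrix.map_apply, Pi.smul_apply, smul_eq_mul] at hb'
      simp only [scaledCycleMatrix, cycleOffsetMap, Matrix.mulVec, dotProduct, Matrix.map_apply,
        Pi.smul_apply, smul_eq_mul, Pi.add_apply, Matrix.of_apply, Finset.mul_sum]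
      rw [← Finset.sum_add_distrib]
      have : z b = (∑ a, (Γ b a : ℝ) * x a) / I.T := by rw [hb']; field_simp
      rw [this, Finset.sum_div]
      refine Finset.sum_congr rfl fun a _ => ?_
      have := (sub_pos.2 (h.l_lt_u a)).ne'
      field_simp
      ring
  · rintro ⟨y, hy, rfl⟩
    refine ⟨fun a => I.l a + (I.u a - I.l a) * y a, ?_, fun a => ?_⟩
    · ext b
      simp only [scaledCycleMatrix, cycleOffsetMap, Matrix.mulVec, dotProduct, Matrix.map_apply,
        Pi.smul_apply, smul_eq_mul, Pi.add_apply, Matrix.of_apply, Finset.mul_sum]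
      rw [← Finset.sum_add_distrib, Finset.mul_sum]
      refine Finset.sum_congr rfl fun a _ => ?_
      field_simp
      ring
    · have := sub_pos.2 (h.l_lt_u a)
      constructor <;> nlinarith [(hy a).1, (hy a).2]

/-- The polytrope `ℜ(z)` in the torus: the image of `R(p)` for any `p` with `Γ p = z` (these images
all coincide, so that their union is taken). -/
def polytrope (z : 𝓑 → ℤ) : Set I.Torus :=
  ⋃ p ∈ {p : I.G.Arc → ℤ | Γ *ᵥ p = z}, I.toTorus '' I.R p

/-- The vertices of `ℜ(z)`: the points of the torus represented by a `π ∈ R(p)`, `Γ p = z`, whose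
class is a vertex (extreme point) of the polytope `R(p)/ℝ𝟏`. -/
def polytropeVertices (z : 𝓑 → ℤ) : Set I.Torus :=
  {τ | ∃ (p : I.G.Arc → ℤ) (π : V → ℝ), Γ *ᵥ p = z ∧ π ∈ I.R p ∧ I.toTorus π = τ ∧
    (onesLine V).mkQ π ∈ (I.RModOnes p).extremePoints ℝ}

/-- The points of `ℜ(z)` at which the lower bounds of all arcs in `L` and the upper bounds of all
arcs in `U` are tight, i.e. whose tension lies in `𝓕_{L,U}`. -/
def polytropeTightSet (z : 𝓑 → ℤ) (L U : Set I.G.Arc) : Set I.Torus :=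
  {τ | ∃ (p : I.G.Arc → ℤ) (π : V → ℝ), Γ *ᵥ p = z ∧ π ∈ I.R p ∧ I.toTorus π = τ ∧
    I.tension p π ∈ I.boxFace L U}

/-- `τ` is a vertex of `ℜ(z)` defined by `(S, L, U)`: it is a vertex, and it is the unique point of
`ℜ(z)` at which the bounds prescribed by `L` and `U` are tight. -/
def IsVertexDefinedBy (z : 𝓑 → ℤ) (L U : Set I.G.Arc) (τ : I.Torus) : Prop :=
  τ ∈ I.polytrope Γ z ∧ τ ∈ I.polytropeVertices Γ z ∧ I.polytropeTightSet Γ z L U = {τ}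

end PESPInstance

end

/-!
The columns of `Γ'` that generate a tile form a basis, and complements of column bases of a cycle
matrix are spanning trees (`Digraph.IsIntegralCycleMatrix.isTree_of_columns`). What has to be
explained is why a tile is the image of a face of the box `l ≤ x ≤ u`, that is, why its corner is
the base point of the zonotope `Z` plus a sum of generators that the tile does not use. This holds
for fine zonotopal tilings of arbitrary zonotopes (`BoxFamily.IsTilingOf.exists_corner_eq`,
`IsFineZonotopalTiling.exists_eq_faceImage`), for the following reason.

After changing signs, no two nonzero generators are opposite. For a vector `v ≠ 0`, the *zone* of
`v` consists of the interior points of `Z` at which the minimal face of the tiling has `v` as a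
generator; this does not depend on the tile containing the point, because the tiles meet in common
faces (`BoxFamily.IsTilingOf.exists_gen_eq`). A line in direction `v` through the interior of `Z`
meets the zone in disjoint open intervals of the length of `v`, and the length of the zone below a
point of the line depends continuously on the point
(`BoxFamily.IsTilingOf.continuousAt_zoneLength`). On a tile, this height is an integer, plus the
coordinate of the point that belongs to `v` if `v` is a generator of the tile
(`BoxFamily.IsTilingOf.exists_zoneLength_eq`).

The number `n` of intervals is the same for all lines, being continuous and integral. It is at
most the number of generators equal to `v` (`BoxFamily.IsTilingOf.card_entries_le`). Indeed, by
Cavalieri's principle the volume of the zone is `n` times the volume of the shadow of `Z` in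
direction `v`. On the other hand, the tiles use different bases, so that the volume of the zone is
at most the sum, over the generators equal to `v` and the bases containing the generator, of the
volumes of the parallelepipeds. For a single generator this sum is at most the shadow
(`sum_measure_parallelepiped_le_shadowSlab`): stretching the generator by a factor `1 + M`
multiplies the sum by `1 + M`, and the volume of the stretched zonotope is at most `M` plus a
constant times the shadow, while the sum over all bases is a lower bound for the volume of a
zonotope (`sum_measure_parallelepiped_le`); let `M` tend to infinity.

The combination of the generators with the heights as coefficients differs from the position of
the point by a vector that is continuous and takes only finitely many values, hence is constant;
and this constant is the base point of `Z`, because otherwise `Z` would contain a proper translate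
of itself (`BoxFamily.IsTilingOf.eq_add_sum_zoneLength`). Comparing the integral parts on a tile
expresses its corner as the base point plus an integral combination of generators; the bounds on
the number of intervals leave enough unused copies of each generator to make this a subset sum.

The statement on polytropes is about tensions. If `z = Γ x / T` with `x` in the face of the box
and `z = Γ p` is integral, then `x - T p` lies in the kernel of `Γ` and hence is a potential
difference (`Digraph.IsIntegralCycleMatrix.exists_potential`). The potential is a vertex, and the
only point of the polytrope with tension in the face, because prescribing the tension on a
spanning tree determines the potential up to a constant (`PESPInstance.exists_isVertexDefinedBy`).
-/

/-! ### Flows, cycles and forests in digraphs -/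

namespace Digraph

variable {V : Type*} {G : Digraph V}

theorem spanningSubgraph_adj {S : Set G.Arc} {i j : V} :
    (G.spanningSubgraph S).Adj i j ↔ i ≠ j ∧
      ((∃ a ∈ S, src a = i ∧ tgt a = j) ∨ (∃ a ∈ S, src a = j ∧ tgt a = i)) := by
  simp only [spanningSubgraph, SimpleGraph.fromRel_adj]
  refine and_congr_right fun _ => or_congr ?_ ?_ <;>
  · constructor
    · rintro ⟨h, hS⟩
      exact ⟨_, hS, rfl, rfl⟩
    · rintro ⟨⟨⟨x, y⟩, h⟩, hS, rfl, rfl⟩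
      exact ⟨h, hS⟩

theorem src_ne_tgt (hl : ∀ i, ¬ G.Adj i i) (a : G.Arc) : src a ≠ tgt a := by
  rcases a with ⟨⟨x, y⟩, h⟩
  rintro (rfl : x = y)
  exact hl _ h

theorem spanningSubgraph_adj_of_mem (hl : ∀ i, ¬ G.Adj i i) {S : Set G.Arc} {a : G.Arc}
    (ha : a ∈ S) : (G.spanningSubgraph S).Adj (src a) (tgt a) :=
  spanningSubgraph_adj.2 ⟨src_ne_tgt hl a, Or.inl ⟨a, ha, rfl, rfl⟩⟩

/-- Without antiparallel arcs, an arc is determined by its underlying edge. -/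
theorem arc_eq_of_edge_eq (ha : ∀ i j, G.Adj i j → ¬ G.Adj j i) {a b : G.Arc}
    (h : s(src a, tgt a) = s(src b, tgt b)) : a = b := by
  rcases a with ⟨⟨x, y⟩, hxy⟩
  rcases b with ⟨⟨z, w⟩, hzw⟩
  rcases Sym2.eq_iff.1 h with ⟨h1, h2⟩ | ⟨h1, h2⟩
  · exact Subtype.ext (Prod.ext h1 h2)
  · exfalso
    change x = w at h1
    change y = z at h2
    subst h1 h2
    exact ha _ _ hxy hzw

/-- A vertex function is constant if it takes the same values at the ends of all arcs of a
connected spanning subgraph. -/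
theorem apply_eq_of_connected {X : Type*} {S : Set G.Arc} (hS : (G.spanningSubgraph S).Connected)
    {π : V → X} (h : ∀ a ∈ S, π (tgt a) = π (src a)) (u v : V) : π u = π v := by
  obtain ⟨p⟩ := hS.preconnected u v
  induction p with
  | nil => rfl
  | cons hadj p ih =>
    rw [← ih]
    obtain ⟨_, ⟨a, haS, rfl, rfl⟩ | ⟨a, haS, rfl, rfl⟩⟩ := spanningSubgraph_adj.1 hadj
    · exact (h a haS).symm
    · exact h a haS

/-- The spanning tree is given by its arcs, as a subset of the arc set. -/
theorem exists_spanning_tree (h : (G.spanningSubgraph Set.univ).Connected) :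
    ∃ S : Set G.Arc, (G.spanningSubgraph S).IsTree := by
  obtain ⟨T, hT, hT'⟩ := h.exists_isTree_le
  refine ⟨{a | T.Adj (src a) (tgt a)}, ?_⟩
  convert hT'
  ext i j
  rw [spanningSubgraph_adj]
  constructor
  · rintro ⟨_, ⟨a, ha, rfl, rfl⟩ | ⟨a, ha, rfl, rfl⟩⟩
    · exact ha
    · exact ha.symm
  · intro hij
    obtain ⟨hne, ⟨a, _, rfl, rfl⟩ | ⟨a, _, rfl, rfl⟩⟩ := spanningSubgraph_adj.1 (hT hij)
    · exact ⟨hne, Or.inl ⟨a, hij, rfl, rfl⟩⟩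
    · exact ⟨hne, Or.inr ⟨a, hij.symm, rfl, rfl⟩⟩

variable [Fintype V] [DecidableEq V]

theorem incidence_mulVec_apply (f : G.Arc → ℤ) (v : V) :
    (G.incidence *ᵥ f) v =
      ∑ a, f a * ((if src a = v then 1 else 0) - (if tgt a = v then 1 else 0)) := by
  simp only [Matrix.mulVec, dotProduct, incidence, Matrix.of_apply]
  exact Finset.sum_congr rfl fun a _ => mul_comm _ _

/-- Summation by parts: the pairing of an arc vector with a coboundary. -/
theorem sum_mul_sub_potential (f : G.Arc → ℤ) (π : V → ℝ) :
    ∑ a, (f a : ℝ) * (π (src a) - π (tgt a)) = ∑ v, ((G.incidence *ᵥ f) v : ℝ) * π v := by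
  simp only [incidence_mulVec_apply, Int.cast_sum, Finset.sum_mul]
  rw [Finset.sum_comm]
  refine Finset.sum_congr rfl fun a _ => ?_
  simp only [Int.cast_mul, mul_assoc, ← Finset.mul_sum]
  congr 1
  simp [sub_mul, Finset.sum_sub_distrib]

theorem sum_mul_potential_eq_zero {f : G.Arc → ℤ} (hf : G.incidence *ᵥ f = 0) (π : V → ℝ) :
    ∑ a, (f a : ℝ) * (π (tgt a) - π (src a)) = 0 := by
  have h := sum_mul_sub_potential f π
  simp only [hf, Pi.zero_apply, Int.cast_zero, zero_mul, Finset.sum_const_zero] at h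
  rw [← neg_eq_zero, ← Finset.sum_neg_distrib, ← h]
  exact Finset.sum_congr rfl fun a _ => by ring

theorem incidence_mulVec_single [DecidableEq G.Arc] (a : G.Arc) (c : ℤ) :
    G.incidence *ᵥ (Pi.single a c) =
      Pi.single (src a) c - Pi.single (tgt a) c := by
  ext v
  rw [incidence_mulVec_apply, Finset.sum_eq_single a]
  · simp only [Pi.single_eq_same, Pi.sub_apply, Pi.single_apply, mul_sub, mul_ite, mul_one,
      mul_zero, eq_comm (a := v)]
  · intro b _ hb
    simp [Pi.single_eq_of_ne hb]
  · simp

/-- The unit flow along a path: a vector with entries in `{-1, 0, 1}` that is supported on the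
arcs of the path and has the ends of the path as its source and sink. -/
theorem exists_path_flow {S : Set G.Arc} {u v : V}
    (p : (G.spanningSubgraph S).Walk u v) (hp : p.IsPath) :
    ∃ f : G.Arc → ℤ, (∀ a, f a = -1 ∨ f a = 0 ∨ f a = 1) ∧
      (∀ a, f a ≠ 0 → a ∈ S ∧ s(src a, tgt a) ∈ p.edges) ∧
      G.incidence *ᵥ f = Pi.single u 1 - Pi.single v 1 := by
  classical
  induction p with
  | nil => exact ⟨0, by simp, by simp, by simp⟩
  | @cons u w v h p ih =>
    rw [SimpleGraph.Walk.cons_isPath_iff] at hp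
    obtain ⟨f, hf1, hf2, hf3⟩ := ih hp.1
    have key : ∀ a ∈ S, s(src a, tgt a) = s(u, w) → ∀ c : ℤ, (c = 1 ∨ c = -1) →
        (∀ b, (f + Pi.single a c : G.Arc → ℤ) b = -1 ∨ (f + Pi.single a c : G.Arc → ℤ) b = 0 ∨
          (f + Pi.single a c : G.Arc → ℤ) b = 1) ∧
        (∀ b, (f + Pi.single a c : G.Arc → ℤ) b ≠ 0 →
          b ∈ S ∧ s(src b, tgt b) ∈ (SimpleGraph.Walk.cons h p).edges) := by
      intro a haS hae c hc
      -- the new arc is not yet used, because the path does not return to its starting vertex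
      have hfa : f a = 0 := by
        by_contra hne
        have := (hf2 a hne).2
        rw [hae] at this
        exact hp.2 (p.fst_mem_support_of_mem_edges this)
      constructor
      · intro b
        by_cases hb : b = a
        · subst hb
          rcases hc with rfl | rfl <;> simp [hfa]
        · simpa [Pi.single_eq_of_ne hb] using hf1 b
      · intro b hb'
        by_cases hb : b = a
        · subst hb
          exact ⟨haS, by simp [hae]⟩
        · simp only [Pi.add_apply, Pi.single_eq_of_ne hb, add_zero] at hb'
          exact ⟨(hf2 b hb').1, by simp [(hf2 b hb').2]⟩
    obtain ⟨_, ⟨a, haS, rfl, rfl⟩ | ⟨a, haS, rfl, rfl⟩⟩ := spanningSubgraph_adj.1 h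
    · obtain ⟨h1, h2⟩ := key a haS rfl 1 (Or.inl rfl)
      refine ⟨f + Pi.single a 1, h1, h2, ?_⟩
      rw [Matrix.mulVec_add, hf3, incidence_mulVec_single]
      abel
    · obtain ⟨h1, h2⟩ := key a haS Sym2.eq_swap (-1) (Or.inr rfl)
      refine ⟨f + Pi.single a (-1), h1, h2, ?_⟩
      rw [Matrix.mulVec_add, hf3, incidence_mulVec_single]
      simp only [Pi.single_neg]
      abel

/-- The fundamental cycle of an arc outside of a connected spanning subgraph. -/
theorem exists_fundamental_cycle {S : Set G.Arc} (hS : (G.spanningSubgraph S).Connected)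
    {e : G.Arc} (he : e ∉ S) :
    ∃ γ : G.Arc → ℤ, G.IsOrientedCycle γ ∧ γ e = 1 ∧ ∀ a, a ∉ S → a ≠ e → γ a = 0 := by
  classical
  obtain ⟨p, hp⟩ := (hS.preconnected (tgt e) (src e)).exists_isPath
  obtain ⟨f, hf1, hf2, hf3⟩ := exists_path_flow p hp
  have hf : ∀ a, a ∉ S → f a = 0 := fun a ha => by
    by_contra h
    exact ha (hf2 a h).1
  refine ⟨f + Pi.single e 1, ⟨fun a => ?_, ?_⟩, by simp [hf e he], fun a ha hae => ?_⟩
  · by_cases h : a = e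
    · subst h
      simp [hf a he]
    · simpa [Pi.single_eq_of_ne h] using hf1 a
  · rw [Matrix.mulVec_add, hf3, incidence_mulVec_single]
    abel
  · simp [hf a ha, Pi.single_eq_of_ne hae]

/-- An edge of `S` that is not a bridge, together with a path that avoids it, would give a nonzero
oriented cycle supported on `S`. -/
theorem isAcyclic_of_forall_isOrientedCycle {S : Set G.Arc}
    (h : ∀ γ : G.Arc → ℤ, G.IsOrientedCycle γ → (∀ a, a ∉ S → γ a = 0) → γ = 0) :
    (G.spanningSubgraph S).IsAcyclic := by
  classical
  rw [SimpleGraph.isAcyclic_iff_forall_isBridge]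
  have key : ∀ a ∈ S, ∀ (p : (G.spanningSubgraph S).Walk (tgt a) (src a)),
      s(src a, tgt a) ∈ p.edges := by
    intro a haS p
    by_contra hp
    obtain ⟨f, hf1, hf2, hf3⟩ := exists_path_flow p.bypass p.bypass_isPath
    have hfa : f a = 0 := by
      by_contra hne
      exact hp (p.edges_bypass_subset_edges (hf2 a hne).2)
    have := h (f + Pi.single a 1) ⟨fun b => ?_, ?_⟩ fun b hb => ?_
    · simpa [hfa] using congrFun this a
    · by_cases hb : b = a
      · subst hb
        simp [hfa]
      · simpa [Pi.single_eq_of_ne hb] using hf1 b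
    · rw [Matrix.mulVec_add, hf3, incidence_mulVec_single]
      abel
    · have hba : b ≠ a := fun hba => hb (hba ▸ haS)
      simp only [Pi.add_apply, Pi.single_eq_of_ne hba, add_zero]
      by_contra hne
      exact hb (hf2 b hne).1
  intro e he
  induction e using Sym2.ind with
  | _ x y =>
    rw [SimpleGraph.isBridge_iff_forall_walk_mem_edges]
    obtain ⟨_, ⟨a, haS, rfl, rfl⟩ | ⟨a, haS, rfl, rfl⟩⟩ := spanningSubgraph_adj.1 he
    · intro p
      simpa using key a haS p.reverse
    · intro p
      rw [Sym2.eq_swap]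
      exact key a haS p

/-- A circulation supported on a forest vanishes: count the flow through the cut belonging to a
bridge. -/
theorem eq_zero_of_incidence_mulVec_eq_zero (hl : ∀ i, ¬ G.Adj i i)
    (hanti : ∀ i j, G.Adj i j → ¬ G.Adj j i) {S : Set G.Arc}
    (hS : (G.spanningSubgraph S).IsAcyclic) {f : G.Arc → ℤ} (hf : G.incidence *ᵥ f = 0)
    (hfS : ∀ a, a ∉ S → f a = 0) : f = 0 := by
  classical
  ext e
  by_cases he : e ∈ S
  swap
  · exact hfS e he
  set H := G.spanningSubgraph S
  have hadj : H.Adj (src e) (tgt e) := spanningSubgraph_adj_of_mem hl he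
  have hb : H.IsBridge s(src e, tgt e) :=
    SimpleGraph.isAcyclic_iff_forall_isBridge.1 hS ((SimpleGraph.mem_edgeSet _).2 hadj)
  rw [SimpleGraph.isBridge_iff] at hb
  set K := H.deleteEdges {s(src e, tgt e)}
  have h0 := sum_mul_potential_eq_zero hf (fun v => if K.Reachable (src e) v then 1 else 0)
  rw [Finset.sum_eq_single e] at h0
  · have h1 : K.Reachable (src e) (src e) := SimpleGraph.Reachable.refl _
    rw [if_neg hb, if_pos h1] at h0
    simpa using h0
  · intro a _ hae
    by_cases ha : a ∈ S
    · have hK : K.Adj (src a) (tgt a) := by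
        rw [SimpleGraph.deleteEdges_adj]
        exact ⟨spanningSubgraph_adj_of_mem hl ha, fun h => hae (arc_eq_of_edge_eq hanti h)⟩
      have : K.Reachable (src e) (tgt a) ↔ K.Reachable (src e) (src a) :=
        ⟨fun h => h.trans hK.symm.reachable, fun h => h.trans hK.reachable⟩
      simp [this]
    · simp [hfS a ha]
  · simp

end Digraph

/-! ### Cycle matrices of integral cycle bases -/

namespace Digraph

variable {V : Type*} {G : Digraph V} [Fintype V] [DecidableEq V]

/-- Every integral circulation is an integral combination of fundamental cycles. -/
theorem exists_fundamental_expansion (hl : ∀ i, ¬ G.Adj i i)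
    (hanti : ∀ i j, G.Adj i j → ¬ G.Adj j i) {S : Set G.Arc}
    (hS : (G.spanningSubgraph S).IsTree) :
    ∃ γ : G.Arc → G.Arc → ℤ, (∀ e, γ e ∈ G.cycleSpace) ∧ (∀ e ∈ S, γ e = 0) ∧
      ∀ f : G.Arc → ℤ, G.incidence *ᵥ f = 0 → f = ∑ e, f e • γ e := by
  classical
  choose! γ hγ using fun e (he : e ∉ S) => exists_fundamental_cycle hS.connected he
  refine ⟨fun e => if e ∈ S then 0 else γ e, fun e => ?_, fun e he => if_pos he, fun f hf => ?_⟩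
  · by_cases he : e ∈ S
    · simp [he]
    · have : γ e ∈ G.cycleSpace := Submodule.subset_span (hγ e he).1
      simpa [he] using this
  · rw [← sub_eq_zero]
    refine eq_zero_of_incidence_mulVec_eq_zero hl hanti hS.isAcyclic ?_ fun a ha => ?_
    · rw [Matrix.mulVec_sub, hf, Matrix.mulVec_sum, zero_sub, neg_eq_zero]
      refine Finset.sum_eq_zero fun e _ => ?_
      rw [Matrix.mulVec_smul]
      by_cases he : e ∈ S
      · simp [he]
      · simp [he, (hγ e he).1.2]
    · rw [Pi.sub_apply, Finset.sum_apply, Finset.sum_eq_single a]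
      · simp [ha, (hγ a ha).2.1]
      · intro e _ hea
        by_cases he : e ∈ S
        · simp [he]
        · simp [he, (hγ e he).2.2 a ha hea.symm]
      · simp

theorem mem_cycleSpace_of_incidence_mulVec_eq_zero (hl : ∀ i, ¬ G.Adj i i)
    (hanti : ∀ i j, G.Adj i j → ¬ G.Adj j i)
    (hconn : (G.spanningSubgraph Set.univ).Connected) {f : G.Arc → ℤ}
    (hf : G.incidence *ᵥ f = 0) : f ∈ G.cycleSpace := by
  obtain ⟨S, hS⟩ := exists_spanning_tree hconn
  obtain ⟨γ, hγ, -, h⟩ := exists_fundamental_expansion hl hanti hS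
  rw [h f hf]
  exact Submodule.sum_mem _ fun e _ => Submodule.smul_mem _ _ (hγ e)

namespace IsIntegralCycleMatrix

variable {𝓑 : Type*} [Fintype 𝓑] {Γ : Matrix 𝓑 G.Arc ℤ} (hΓ : G.IsIntegralCycleMatrix Γ)
include hΓ

theorem linearIndependent_rows : LinearIndependent ℤ Γ := by
  have h1 : ∀ i, Γ i ∈ G.cycleSpace := fun i =>
    hΓ.span_eq ▸ Submodule.subset_span (Set.mem_range_self i)
  have hli : LinearIndependent ℤ (fun i => (⟨Γ i, h1 i⟩ : G.cycleSpace)) := by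
    refine linearIndependent_of_top_le_span_of_card_eq_finrank ?_ hΓ.card_eq
    intro x _
    have hx : (x : G.Arc → ℤ) ∈ Submodule.span ℤ (Set.range Γ) := hΓ.span_eq.symm ▸ x.2
    have hmap : Submodule.map G.cycleSpace.subtype
        (Submodule.span ℤ (Set.range fun i => (⟨Γ i, h1 i⟩ : G.cycleSpace))) =
        Submodule.span ℤ (Set.range Γ) := by
      rw [Submodule.map_span, ← Set.range_comp]
      rfl
    rw [← hmap] at hx
    obtain ⟨y, hy, hyx⟩ := hx
    rwa [← Subtype.ext hyx]
  exact hli.map' G.cycleSpace.subtype (Submodule.ker_subtype _)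

theorem exists_rows_expansion {f : G.Arc → ℤ} (hf : f ∈ G.cycleSpace) :
    ∃ c : 𝓑 → ℤ, ∑ i, c i • Γ i = f :=
  (Submodule.mem_span_range_iff_exists_fun ℤ).1 (hΓ.span_eq.symm ▸ hf)

/-- Circulations pair to zero with every real vector in the kernel of the cycle matrix. -/
theorem sum_mul_eq_zero_of_mulVec_eq_zero {y : G.Arc → ℝ}
    (hy : Γ.map (Int.cast : ℤ → ℝ) *ᵥ y = 0) {f : G.Arc → ℤ} (hf : f ∈ G.cycleSpace) :
    ∑ a, (f a : ℝ) * y a = 0 := by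
  obtain ⟨c, rfl⟩ := hΓ.exists_rows_expansion hf
  have h : ∀ i, ∑ a, (Γ i a : ℝ) * y a = 0 := fun i => congrFun hy i
  simp only [Finset.sum_apply, Pi.smul_apply, smul_eq_mul, Int.cast_sum, Int.cast_mul,
    Finset.sum_mul]
  rw [Finset.sum_comm]
  refine Finset.sum_eq_zero fun i _ => ?_
  simp only [mul_assoc, ← Finset.mul_sum, h, mul_zero]

theorem mulVec_tension_eq_zero (π : V → ℝ) :
    Γ.map (Int.cast : ℤ → ℝ) *ᵥ (fun a => π (tgt a) - π (src a)) = 0 := by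
  ext i
  exact sum_mul_potential_eq_zero (hΓ.isOrientedCycle i).2 π

/-- A real arc vector orthogonal to the cycle space is a potential difference. -/
theorem exists_potential (hl : ∀ i, ¬ G.Adj i i)
    (hanti : ∀ i j, G.Adj i j → ¬ G.Adj j i)
    (hconn : (G.spanningSubgraph Set.univ).Connected) {y : G.Arc → ℝ}
    (hy : Γ.map (Int.cast : ℤ → ℝ) *ᵥ y = 0) :
    ∃ π : V → ℝ, ∀ a, y a = π (tgt a) - π (src a) := by
  classical
  obtain ⟨r⟩ := hconn.nonempty
  have hflow : ∀ v, ∃ f : G.Arc → ℤ, G.incidence *ᵥ f = Pi.single r 1 - Pi.single v 1 := by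
    intro v
    obtain ⟨p, hp⟩ := (hconn.preconnected r v).exists_isPath
    obtain ⟨f, -, -, hf⟩ := exists_path_flow p hp
    exact ⟨f, hf⟩
  choose f hf using hflow
  refine ⟨fun v => ∑ a, (f v a : ℝ) * y a, fun e => ?_⟩
  -- the path to the tail, the arc, and the path to the head back form a circulation
  have hcirc : G.incidence *ᵥ (f (src e) + Pi.single e 1 - f (tgt e)) = 0 := by
    rw [Matrix.mulVec_sub, Matrix.mulVec_add, hf, hf, incidence_mulVec_single]
    abel
  have h0 := hΓ.sum_mul_eq_zero_of_mulVec_eq_zero hy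
    (mem_cycleSpace_of_incidence_mulVec_eq_zero hl hanti hconn hcirc)
  have he : ∑ a, ((Pi.single e 1 : G.Arc → ℤ) a : ℝ) * y a = y e := by
    rw [Finset.sum_eq_single e]
    · simp
    · intro b _ hb
      simp [Pi.single_eq_of_ne hb]
    · simp
  simp only [Pi.sub_apply, Pi.add_apply, Int.cast_sub, Int.cast_add, sub_mul, add_mul,
    Finset.sum_sub_distrib, Finset.sum_add_distrib, he] at h0
  linarith

/-- The cycle matrix of an integral cycle basis is surjective on integer vectors: the coefficients
of the fundamental cycles of a spanning tree in the basis form a right inverse. -/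
theorem exists_mulVec_eq (hl : ∀ i, ¬ G.Adj i i)
    (hanti : ∀ i j, G.Adj i j → ¬ G.Adj j i)
    (hconn : (G.spanningSubgraph Set.univ).Connected) (z : 𝓑 → ℤ) :
    ∃ p : G.Arc → ℤ, Γ *ᵥ p = z := by
  classical
  obtain ⟨S, hS⟩ := exists_spanning_tree hconn
  obtain ⟨γ, hγ, -, hexp⟩ := exists_fundamental_expansion hl hanti hS
  choose M hM using fun e => hΓ.exists_rows_expansion (hγ e)
  have key : ∀ b b', ∑ e, Γ b e * M e b' = if b' = b then 1 else 0 := by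
    intro b
    have h1 : ∑ b', (∑ e, Γ b e * M e b') • Γ b' = Γ b := by
      refine Eq.trans ?_ (hexp (Γ b) (hΓ.isOrientedCycle b).2).symm
      simp only [← hM, Finset.smul_sum, Finset.sum_smul, smul_smul]
      rw [Finset.sum_comm]
    have h2 : ∑ b', ((∑ e, Γ b e * M e b') - if b' = b then 1 else 0) • Γ b' = 0 := by
      rw [Finset.sum_congr rfl fun b' _ => sub_smul _ _ (Γ b'), Finset.sum_sub_distrib, h1,
        Finset.sum_eq_single b (fun b' _ h => by rw [if_neg h, zero_smul]) (by simp), if_pos rfl,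
        one_smul, sub_self]
    intro b'
    exact sub_eq_zero.1 (Fintype.linearIndependent_iff.1 hΓ.linearIndependent_rows _ h2 b')
  refine ⟨fun e => ∑ b', M e b' * z b', ?_⟩
  ext b
  simp only [Matrix.mulVec, dotProduct, Finset.mul_sum, ← mul_assoc]
  rw [Finset.sum_comm]
  simp only [← Finset.sum_mul, key]
  simp

end IsIntegralCycleMatrix

end Digraph

namespace Digraph

variable {V : Type*} {G : Digraph V} [Fintype V] [DecidableEq V]

/-- Complements of column bases of the cycle matrix are spanning trees: a cut without arcs of `S`
would be a linear relation between the columns outside of `S`, and an oriented cycle inside of `S`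
would be a linear relation between the rows that remain when the columns in `S` are deleted. -/
theorem IsIntegralCycleMatrix.isTree_of_columns {𝓑 : Type*} [Fintype 𝓑] {Γ : Matrix 𝓑 G.Arc ℤ}
    (hΓ : G.IsIntegralCycleMatrix Γ) (hconn : (G.spanningSubgraph Set.univ).Connected)
    (hl : ∀ i, ¬ G.Adj i i) {S : Set G.Arc}
    (hind : ∀ y : G.Arc → ℝ, (∀ a ∈ S, y a = 0) → Γ.map (Int.cast : ℤ → ℝ) *ᵥ y = 0 → y = 0)
    (hspan : ∀ c : 𝓑 → ℤ, (∀ a, a ∉ S → ∑ i, c i * Γ i a = 0) → c = 0) :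
    (G.spanningSubgraph S).IsTree := by
  classical
  have := hconn.nonempty
  refine ⟨⟨fun u v => ?_⟩, ?_⟩
  · set H := G.spanningSubgraph S
    set π : V → ℝ := fun w => if H.Reachable u w then 1 else 0 with hπ
    have hy : (fun a : G.Arc => π (tgt a) - π (src a)) = 0 := by
      refine hind _ (fun a ha => ?_) (hΓ.mulVec_tension_eq_zero π)
      have hadj : H.Adj (src a) (tgt a) := spanningSubgraph_adj_of_mem hl ha
      have : H.Reachable u (tgt a) ↔ H.Reachable u (src a) :=
        ⟨fun h => h.trans hadj.symm.reachable, fun h => h.trans hadj.reachable⟩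
      simp [hπ, this]
    have huv : π u = π v :=
      apply_eq_of_connected hconn (fun a _ => sub_eq_zero.1 (congrFun hy a)) u v
    by_contra hne
    simp [hπ, hne] at huv
  · refine isAcyclic_of_forall_isOrientedCycle fun γ hγ hγS => ?_
    obtain ⟨c, rfl⟩ := hΓ.exists_rows_expansion (Submodule.subset_span hγ)
    have hc : c = 0 := hspan c fun a ha => by simpa using hγS a ha
    simp [hc]

end Digraph

/-! ### Vertices of polytropes -/

namespace PESPInstance

open Digraph

variable {V : Type*} {I : PESPInstance V}

theorem mkQ_onesLine_eq_iff [Nonempty V] {π ρ : V → ℝ} :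
    (onesLine V).mkQ π = (onesLine V).mkQ ρ ↔ ∃ c : ℝ, ∀ v, π v = ρ v + c := by
  rw [Submodule.mkQ_apply, Submodule.mkQ_apply, Submodule.Quotient.eq, onesLine,
    Submodule.mem_span_singleton]
  constructor
  · rintro ⟨c, hc⟩
    refine ⟨c, fun v => ?_⟩
    have := congrFun hc v
    simp only [Pi.smul_apply, Pi.one_apply, smul_eq_mul, mul_one, Pi.sub_apply] at this
    linarith
  · rintro ⟨c, hc⟩
    refine ⟨c, funext fun v => ?_⟩
    simp [hc v]

theorem mkQ_onesLine_eq_of_tension_eq {S : Set I.G.Arc}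
    (hS : (I.G.spanningSubgraph S).Connected) {π ρ : V → ℝ}
    (h : ∀ a ∈ S, π (tgt a) - π (src a) = ρ (tgt a) - ρ (src a)) :
    (onesLine V).mkQ π = (onesLine V).mkQ ρ := by
  have := hS.nonempty
  obtain ⟨r⟩ := hS.nonempty
  refine mkQ_onesLine_eq_iff.2 ⟨π r - ρ r, fun v => ?_⟩
  have := apply_eq_of_connected hS (π := fun v => π v - ρ v)
    (fun a ha => by linarith [h a ha]) v r
  linarith

theorem mem_R_iff {p : I.G.Arc → ℤ} {π : V → ℝ} :
    π ∈ I.R p ↔ ∀ a, I.l a ≤ I.tension p π a ∧ I.tension p π a ≤ I.u a := by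
  simp only [R, tension, Set.mem_ofPred_eq]
  refine forall_congr' fun a => ?_
  constructor <;> rintro ⟨h1, h2⟩ <;> constructor <;> linarith

/-- Potentials with the same tension, up to different choices of the integral offsets, represent
the same point of the torus. -/
theorem toTorus_eq_of_tension_eq (hconn : (I.G.spanningSubgraph Set.univ).Connected)
    {p q : I.G.Arc → ℤ} {π ρ : V → ℝ} (h : I.tension p π = I.tension q ρ) :
    I.toTorus π = I.toTorus ρ := by
  obtain ⟨r⟩ := hconn.nonempty
  have hint : ∀ v, ∃ k : ℤ, ρ v - π v = (ρ r - π r) + I.T * k := by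
    intro v
    obtain ⟨w⟩ := hconn.preconnected v r
    induction w with
    | nil => exact ⟨0, by simp⟩
    | @cons u v r hadj w ih =>
      obtain ⟨k, hk⟩ := ih
      obtain ⟨_, ⟨a, _, rfl, rfl⟩ | ⟨a, _, rfl, rfl⟩⟩ := spanningSubgraph_adj.1 hadj
      · have := congrFun h a
        simp only [tension] at this
        exact ⟨k + (q a - p a), by push_cast; linear_combination this + hk⟩
      · have := congrFun h a
        simp only [tension] at this
        exact ⟨k - (q a - p a), by push_cast; linear_combination hk - this⟩
  choose k hk using hint
  refine (QuotientAddGroup.eq).2 ?_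
  refine AddSubgroup.mem_sup.2 ⟨fun v => I.T * k v, ⟨k, fun v => rfl⟩,
    (ρ r - π r) • 1, Submodule.smul_mem _ _ (Submodule.mem_span_singleton_self _), ?_⟩
  ext v
  have := hk v
  simp only [Pi.add_apply, Pi.smul_apply, Pi.one_apply, smul_eq_mul, mul_one, Pi.neg_apply]
  linarith

/-- If the tension of `π ∈ R(p)` has its values on a spanning tree at the bounds of the box, then
`π` represents a vertex. -/
theorem mkQ_mem_extremePoints (hI : I.Standard) {S L U : Set I.G.Arc}
    (hS : I.IsSpanningTreeStructure S L U) {p : I.G.Arc → ℤ} {π : V → ℝ} (hπ : π ∈ I.R p)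
    (ht : I.tension p π ∈ I.boxFace L U) :
    (onesLine V).mkQ π ∈ (I.RModOnes p).extremePoints ℝ := by
  have := hI.connected.nonempty
  refine ⟨⟨π, hπ, rfl⟩, ?_⟩
  rintro _ ⟨ρ, hρ, rfl⟩ _ ⟨σ, hσ, rfl⟩ ⟨s, t, hs, ht', hst, heq⟩
  rw [← map_smul, ← map_smul, ← map_add, mkQ_onesLine_eq_iff] at heq
  obtain ⟨c, hc⟩ := heq
  refine mkQ_onesLine_eq_of_tension_eq hS.isTree.connected fun a ha => ?_
  have h1 := mem_R_iff.1 hρ a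
  have h2 := mem_R_iff.1 hσ a
  have h3 : I.tension p π a = s * I.tension p ρ a + t * I.tension p σ a := by
    have e1 := hc (tgt a)
    have e2 := hc (src a)
    simp only [Pi.add_apply, Pi.smul_apply, smul_eq_mul] at e1 e2
    simp only [tension]
    have : (I.T : ℝ) * p a = (s + t) * (I.T * p a) := by rw [hst, one_mul]
    linear_combination e2 - e1 + this
  have h4 : I.tension p ρ a = I.tension p π a := by
    rw [hS.eq_union] at ha
    rcases ha with ha | ha
    · have h5 := ht.2.1 a ha
      rw [h5] at h3 ⊢
      refine le_antisymm ?_ h1.1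
      by_contra! hlt
      have : I.l a < s * I.tension p ρ a + t * I.tension p σ a := by
        calc I.l a = s * I.l a + t * I.l a := by rw [← add_mul, hst, one_mul]
          _ < _ := add_lt_add_of_lt_of_le (mul_lt_mul_of_pos_left hlt hs)
            (mul_le_mul_of_nonneg_left h2.1 ht'.le)
      linarith
    · have h5 := ht.2.2 a ha
      rw [h5] at h3 ⊢
      refine le_antisymm h1.2 ?_
      by_contra! hlt
      have : s * I.tension p ρ a + t * I.tension p σ a < I.u a := by
        calc _ < s * I.u a + t * I.u a := add_lt_add_of_lt_of_le (mul_lt_mul_of_pos_left hlt hs)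
              (mul_le_mul_of_nonneg_left h2.2 ht'.le)
          _ = I.u a := by rw [← add_mul, hst, one_mul]
      linarith
  simp only [tension] at h4
  linarith

variable [Fintype V] [DecidableEq V] {𝓑 : Type*} [Fintype 𝓑] {Γ : Matrix 𝓑 I.G.Arc ℤ}

theorem mulVec_tension (hΓ : I.G.IsIntegralCycleMatrix Γ) {p : I.G.Arc → ℤ} {z : 𝓑 → ℤ}
    (hp : Γ *ᵥ p = z) (π : V → ℝ) :
    Γ.map (Int.cast : ℤ → ℝ) *ᵥ I.tension p π = (I.T : ℝ) • fun i => (z i : ℝ) := by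
  have h1 : I.tension p π = (fun a => π (tgt a) - π (src a)) +
      (I.T : ℝ) • fun a => (p a : ℝ) := by
    ext a
    simp [tension]
  rw [h1, Matrix.mulVec_add, hΓ.mulVec_tension_eq_zero, Matrix.mulVec_smul, zero_add]
  congr 1
  ext i
  rw [← hp]
  simp [Matrix.mulVec, dotProduct]

/-- A point of a box face prescribed by a spanning tree is determined by its image under the cycle
matrix. -/
theorem boxFace_injOn (hI : I.Standard) (hΓ : I.G.IsIntegralCycleMatrix Γ) {S L U : Set I.G.Arc}
    (hS : I.IsSpanningTreeStructure S L U) {x y : I.G.Arc → ℝ} (hx : x ∈ I.boxFace L U)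
    (hy : y ∈ I.boxFace L U)
    (h : Γ.map (Int.cast : ℤ → ℝ) *ᵥ x = Γ.map (Int.cast : ℤ → ℝ) *ᵥ y) : x = y := by
  obtain ⟨π, hπ⟩ := hΓ.exists_potential hI.loopless hI.not_antiparallel hI.connected
    (y := x - y) (by rw [Matrix.mulVec_sub, h, sub_self])
  have hconst := apply_eq_of_connected hS.isTree.connected (π := π) fun a ha => by
    have hxy : x a = y a := by
      rw [hS.eq_union] at ha
      rcases ha with ha | ha
      · rw [hx.2.1 a ha, hy.2.1 a ha]
      · rw [hx.2.2 a ha, hy.2.2 a ha]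
    have := hπ a
    rw [Pi.sub_apply, hxy, sub_self] at this
    linarith
  ext a
  have := hπ a
  rw [hconst (tgt a) (src a), sub_self, Pi.sub_apply] at this
  linarith

/-- Integer points in the image of a box face prescribed by a spanning tree give vertices of
polytropes: a preimage differs from `T p` by a tension. -/
theorem exists_isVertexDefinedBy (hI : I.Standard) (hΓ : I.G.IsIntegralCycleMatrix Γ)
    {S L U : Set I.G.Arc} (hS : I.IsSpanningTreeStructure S L U) {z : 𝓑 → ℤ}
    (hz : (fun i => (z i : ℝ)) ∈ I.cycleOffsetMap Γ '' I.boxFace L U) :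
    ∃ τ, I.IsVertexDefinedBy Γ z L U τ := by
  obtain ⟨x, hx, hxz⟩ := hz
  have hT : (I.T : ℝ) ≠ 0 := by exact_mod_cast hI.T_pos.ne'
  have hΓx : Γ.map (Int.cast : ℤ → ℝ) *ᵥ x = (I.T : ℝ) • fun i => (z i : ℝ) := by
    rw [← hxz, cycleOffsetMap, smul_smul, mul_one_div_cancel hT, one_smul]
  obtain ⟨p, hp⟩ := hΓ.exists_mulVec_eq hI.loopless hI.not_antiparallel hI.connected z
  obtain ⟨π, hπ⟩ := hΓ.exists_potential hI.loopless hI.not_antiparallel hI.connected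
    (y := x - I.tension p 0)
    (by rw [Matrix.mulVec_sub, hΓx, mulVec_tension hΓ hp, sub_self])
  have ht : I.tension p π = x := by
    ext a
    have := hπ a
    simp only [Pi.sub_apply, tension, Pi.zero_apply] at this ⊢
    linarith
  have hR : π ∈ I.R p := mem_R_iff.2 fun a => ht ▸ hx.1 a
  refine ⟨I.toTorus π, Set.mem_biUnion (show p ∈ {p | Γ *ᵥ p = z} from hp) ⟨π, hR, rfl⟩,
    ⟨p, π, hp, hR, rfl, mkQ_mem_extremePoints hI hS hR (ht ▸ hx)⟩, ?_⟩
  ext τ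
  constructor
  · rintro ⟨q, ρ, hq, -, rfl, hρ⟩
    refine toTorus_eq_of_tension_eq hI.connected (p := q) (q := p) ?_
    rw [ht]
    exact boxFace_injOn hI hΓ hS hρ hx (by rw [mulVec_tension hΓ hq, hΓx])
  · rintro rfl
    exact ⟨p, π, hp, hR, rfl, ht ▸ hx⟩

end PESPInstance

open MeasureTheory Module

/-! ### A lower bound for the volume of a zonotope -/

section ZonotopeVolume

variable {E : Type*} [NormedAddCommGroup E] [NormedSpace ℝ E] {ι : Type*} [Fintype ι]

open Classical in
/-- The index sets of the bases of `E` among the vectors `a i`. -/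
noncomputable def columnBases (a : ι → E) : Finset (Finset ι) :=
  {B | LinearIndependent ℝ (fun i : B => a i) ∧ B.card = finrank ℝ E}

theorem mem_columnBases {a : ι → E} {B : Finset ι} :
    B ∈ columnBases a ↔ LinearIndependent ℝ (fun i : B => a i) ∧ B.card = finrank ℝ E := by
  simp [columnBases]

/-- The basis of `E` belonging to a member of `columnBases a`. -/
noncomputable def columnBasis [FiniteDimensional ℝ E] {a : ι → E} {B : Finset ι}
    (hB : B ∈ columnBases a) :
    Basis B ℝ E :=
  basisOfLinearIndependentOfCardEqFinrank' (fun i : B => a i) (mem_columnBases.1 hB).1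
    (by simpa using (mem_columnBases.1 hB).2)

@[simp] theorem columnBasis_apply [FiniteDimensional ℝ E] {a : ι → E} {B : Finset ι}
    (hB : B ∈ columnBases a) (i : B) :
    columnBasis hB i = a i := by
  simp [columnBasis]

theorem coe_columnBasis [FiniteDimensional ℝ E] {a : ι → E} {B : Finset ι}
    (hB : B ∈ columnBases a) :
    ⇑(columnBasis hB) = fun i : B => a i := funext fun i => columnBasis_apply hB i

/-- The zonotope generated by the vectors `a i`, translated by `b`. -/
def translatedZonotope (a : ι → E) (b : E) : Set E :=
  {z | ∃ x : ι → ℝ, (∀ i, 0 ≤ x i ∧ x i ≤ 1) ∧ z = b + ∑ i, x i • a i}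

theorem translatedZonotope_eq_preimage (a : ι → E) (b : E) :
    translatedZonotope a b = (fun z => z + -b) ⁻¹' parallelepiped a := by
  ext z
  simp only [translatedZonotope, Set.mem_ofPred_eq, Set.mem_preimage, mem_parallelepiped_iff,
    Set.mem_Icc, Pi.le_def, ← forall_and, Pi.zero_apply, Pi.one_apply]
  refine exists_congr fun x => and_congr_right fun _ => ?_
  rw [← sub_eq_add_neg, sub_eq_iff_eq_add']

theorem convex_translatedZonotope (a : ι → E) (b : E) : Convex ℝ (translatedZonotope a b) := by
  rw [translatedZonotope_eq_preimage]
  exact (convex_parallelepiped a).translate_preimage_left (-b)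

theorem isCompact_parallelepiped (a : ι → E) : IsCompact (parallelepiped a) := by
  have : IsCompact (Set.Icc (0 : ι → ℝ) 1) := isCompact_Icc
  exact this.image (by fun_prop)

theorem isCompact_translatedZonotope (a : ι → E) (b : E) :
    IsCompact (translatedZonotope a b) := by
  rw [translatedZonotope_eq_preimage]
  exact (Homeomorph.addRight (-b)).isCompact_preimage.2 (isCompact_parallelepiped a)

section Basis

variable {J : Type*} [Fintype J] (β : Basis J ℝ E)

/-- The open parallelepiped spanned by a basis. -/
def openBox : Set E := {z | ∀ j, 0 < β.repr z j ∧ β.repr z j < 1}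

theorem continuous_repr_apply (j : J) : Continuous fun z => β.repr z j := by
  have : FiniteDimensional ℝ E := Module.Finite.of_basis β
  exact LinearMap.continuous_of_finiteDimensional (β.coord j)

theorem isOpen_openBox : IsOpen (openBox β) := by
  have : openBox β = ⋂ j, {z | 0 < β.repr z j ∧ β.repr z j < 1} := by
    ext z; simp [openBox]
  rw [this]
  exact isOpen_iInter_of_finite fun j =>
    (isOpen_lt continuous_const (continuous_repr_apply β j)).inter
      (isOpen_lt (continuous_repr_apply β j) continuous_const)

theorem parallelepiped_basis_eq_setOf :
    parallelepiped β = {z | ∀ j, 0 ≤ β.repr z j ∧ β.repr z j ≤ 1} := by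
  rw [parallelepiped_basis_eq]
  ext z
  simp

theorem interior_parallelepiped_subset_openBox :
    interior (parallelepiped β) ⊆ openBox β := by
  classical
  rw [parallelepiped_basis_eq_setOf]
  intro z hz j
  -- moving a little in the directions `± β j` does not leave the parallelepiped
  have hcont : Continuous fun t : ℝ => z + t • β j := by fun_prop
  have hmem : ∀ᶠ t in nhds (0 : ℝ), z + t • β j ∈ {z | ∀ j, 0 ≤ β.repr z j ∧ β.repr z j ≤ 1} :=
    hcont.continuousAt.preimage_mem_nhds (by simpa using mem_interior_iff_mem_nhds.1 hz)
  obtain ⟨ε, hε, h⟩ := Metric.eventually_nhds_iff.1 hmem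
  have hrepr : ∀ t : ℝ, β.repr (z + t • β j) j = β.repr z j + t := fun t => by simp
  have h1 := (h (y := ε / 2) (by rw [Real.dist_eq, sub_zero, abs_of_pos] <;> linarith) j).2
  have h2 := (h (y := -(ε / 2))
    (by rw [Real.dist_eq, sub_zero, abs_neg, abs_of_pos] <;> linarith) j).1
  rw [hrepr] at h1 h2
  constructor <;> linarith

variable [MeasurableSpace E] [BorelSpace E] (μ : Measure E) [μ.IsAddHaarMeasure]

theorem measure_openBox : μ (openBox β) = μ (parallelepiped β) := by
  have : FiniteDimensional ℝ E := Module.Finite.of_basis β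
  refine le_antisymm (measure_mono ?_) ?_
  · rw [parallelepiped_basis_eq_setOf]
    exact fun z hz j => ⟨(hz j).1.le, (hz j).2.le⟩
  · calc μ (parallelepiped β) ≤ μ (closure (parallelepiped β)) := measure_mono subset_closure
      _ ≤ μ (interior (parallelepiped β)) + μ (frontier (parallelepiped β)) := by
        rw [closure_eq_interior_union_frontier]
        exact measure_union_le _ _
      _ = μ (interior (parallelepiped β)) := by
        rw [(convex_parallelepiped _).addHaar_frontier μ, add_zero]
      _ ≤ μ (openBox β) := measure_mono (interior_parallelepiped_subset_openBox β)

/-- Scaling one vector of a basis scales the volume of the parallelepiped. -/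
theorem measure_parallelepiped_update [DecidableEq J] (j : J) (c : ℝ) :
    μ (parallelepiped (Function.update β j (c • β j))) =
      ENNReal.ofReal |c| * μ (parallelepiped β) := by
  have : FiniteDimensional ℝ E := Module.Finite.of_basis β
  set f : E →ₗ[ℝ] E := β.constr ℝ (Function.update β j (c • β j))
  have hf : f ∘ β = Function.update β j (c • β j) := funext fun i => β.constr_basis ℝ _ i
  have hdet : LinearMap.det f = c := by
    have := β.det_comp f β
    rw [hf, AlternatingMap.map_update_smul, Function.update_eq_self, β.det_self] at this
    simpa using this.symm
  rw [← hf, ← image_parallelepiped, Measure.addHaar_image_linearMap, hdet]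

end Basis

section LowerBound

variable [FiniteDimensional ℝ E]

/-- Heights `h` such that, for every basis `B` among the vectors `a i`, the functional that takes
the values `h i` on the basis differs from `h` at all other indices. -/
theorem exists_generic_heights (a : ι → E) :
    ∃ (h : ι → ℝ) (y : Finset ι → E →ₗ[ℝ] ℝ), ∀ B ∈ columnBases a,
      (∀ i ∈ B, h i - y B (a i) = 0) ∧ ∀ i, i ∉ B → h i - y B (a i) ≠ 0 := by
  classical
  let Y : ∀ B : columnBases a, (ι → ℝ) →ₗ[ℝ] (E →ₗ[ℝ] ℝ) := fun B =>
    ((columnBasis B.2).constr ℝ).toLinearMap ∘ₗ LinearMap.funLeft ℝ ℝ (fun i : B.1 => i.1)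
  have hY : ∀ (B : columnBases a) (h : ι → ℝ) (i) (_ : i ∈ B.1), Y B h (a i) = h i := by
    intro B h i hi
    have := (columnBasis B.2).constr_basis ℝ (fun i : B.1 => h i) ⟨i, hi⟩
    rw [columnBasis_apply] at this
    exact this
  let K := {q : columnBases a × ι // q.2 ∉ q.1.1}
  obtain ⟨h, hh⟩ := Module.Dual.exists_forall_ne_zero_of_forall_exists
    (fun q : K => LinearMap.proj q.1.2 - (LinearMap.applyₗ (a q.1.2)) ∘ₗ Y q.1.1) (by
      rintro ⟨⟨B, i⟩, hi⟩
      refine ⟨Pi.single i 1, ?_⟩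
      have : Y B (Pi.single i 1) = 0 := by
        refine (columnBasis B.2).ext fun j => ?_
        have hji : (j : ι) ≠ i := fun hji => hi (hji ▸ j.2)
        rw [columnBasis_apply, hY B _ j j.2, Pi.single_eq_of_ne hji, LinearMap.zero_apply]
      simp [this])
  refine ⟨h, fun B => if hB : B ∈ columnBases a then Y ⟨B, hB⟩ h else 0, fun B hB => ?_⟩
  simp only [dif_pos hB]
  exact ⟨fun i hi => sub_eq_zero.2 (hY ⟨B, hB⟩ h i hi).symm, fun i hi => hh ⟨⟨⟨B, hB⟩, i⟩, hi⟩⟩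

variable [MeasurableSpace E] [BorelSpace E] (μ : Measure E) [μ.IsAddHaarMeasure]

/-- The volume of a zonotope is at least the sum of the volumes of the parallelepipeds belonging to
the bases among its generators.  For generic heights `h`, minimising `h` over the preimages of the
points of the zonotope in the cube gives a tiling: complementary slackness attaches to each basis
`B` a translate of its parallelepiped, and `B` can be read off from the optimal solution at each
interior point of that translate. -/
theorem sum_measure_parallelepiped_le (a : ι → E) :
    ∑ B ∈ columnBases a, μ (parallelepiped fun i : B => a i) ≤ μ (parallelepiped a) := by
  classical
  obtain ⟨h, y, hy⟩ := exists_generic_heights a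
  -- the optimal value of the coordinate `i` for points in the tile of `B`, if `i ∉ B`
  let u : Finset ι → ι → ℝ := fun B i => if h i - y B (a i) < 0 then 1 else 0
  let T : Finset ι → Set E := fun B => {z | ∃ x : ι → ℝ, (∀ i ∈ B, 0 < x i ∧ x i < 1) ∧
    (∀ i, i ∉ B → x i = u B i) ∧ z = ∑ i, x i • a i}
  have hu : ∀ B i, u B i = 0 ∨ u B i = 1 := fun B i => by
    simp only [u]
    split_ifs <;> simp
  have hbox : ∀ (B : Finset ι) (x : ι → ℝ), (∀ i ∈ B, 0 < x i ∧ x i < 1) →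
      (∀ i, i ∉ B → x i = u B i) → ∀ i, 0 ≤ x i ∧ x i ≤ 1 := by
    intro B x h1 h2 i
    by_cases hi : i ∈ B
    · exact ⟨(h1 i hi).1.le, (h1 i hi).2.le⟩
    · rw [h2 i hi]
      rcases hu B i with h | h <;> rw [h] <;> norm_num
  have hsub : ∀ B, T B ⊆ parallelepiped a := by
    rintro B z ⟨x, h1, h2, rfl⟩
    refine (mem_parallelepiped_iff _ _).2 ⟨x, ⟨fun i => ?_, fun i => ?_⟩, rfl⟩
    · exact (hbox B x h1 h2 i).1
    · exact (hbox B x h1 h2 i).2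
  have hopt : ∀ B ∈ columnBases a, ∀ x x' : ι → ℝ, (∀ i, 0 ≤ x' i ∧ x' i ≤ 1) →
      (∀ i, i ∉ B → x i = u B i) → ∑ i, x i • a i = ∑ i, x' i • a i →
      (∑ i, h i * x i ≤ ∑ i, h i * x' i) ∧
      (∑ i, h i * x i = ∑ i, h i * x' i → ∀ i, i ∉ B → x i = x' i) := by
    intro B hB x x' hx' hx heq
    have hterm : ∀ i ∈ Finset.univ,
        (h i - y B (a i)) * x i ≤ (h i - y B (a i)) * x' i := by
      intro i _
      by_cases hi : i ∈ B
      · simp [(hy B hB).1 i hi]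
      · rw [hx i hi]
        by_cases hlt : h i - y B (a i) < 0
        · simp only [u, if_pos hlt]
          nlinarith [hx' i]
        · simp only [u, if_neg hlt, mul_zero]
          exact mul_nonneg (not_lt.1 hlt) (hx' i).1
    have hsum : ∀ x : ι → ℝ, ∑ i, h i * x i =
        ∑ i, (h i - y B (a i)) * x i + y B (∑ i, x i • a i) := by
      intro x
      rw [map_sum, ← Finset.sum_add_distrib]
      refine Finset.sum_congr rfl fun i _ => ?_
      rw [map_smul, smul_eq_mul]
      ring
    rw [hsum x, hsum x', heq, add_le_add_iff_right, add_left_inj]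
    refine ⟨Finset.sum_le_sum hterm, fun h0 i hi => ?_⟩
    exact mul_left_cancel₀ ((hy B hB).2 i hi)
      ((Finset.sum_eq_sum_iff_of_le hterm).1 h0 i (Finset.mem_univ i))
  have hdisj : (columnBases a : Set (Finset ι)).PairwiseDisjoint T := by
    intro B hB B' hB' hne
    refine Set.disjoint_left.2 ?_
    rintro z ⟨x, h1, h2, rfl⟩ ⟨x', h1', h2', heq⟩
    refine hne (Finset.eq_of_subset_of_card_le (fun i hi => ?_) ?_)
    · have o := hopt B hB x x' (hbox B' x' h1' h2') h2 heq
      have o' := hopt B' hB' x' x (hbox B x h1 h2) h2' heq.symm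
      by_contra hi'
      have hxi := o'.2 (le_antisymm o'.1 o.1) i hi'
      rw [h2' i hi'] at hxi
      have := h1 i hi
      rcases hu B' i with h | h <;> rw [h] at hxi <;> rw [← hxi] at this <;> norm_num at this
    · rw [(mem_columnBases.1 hB).2, (mem_columnBases.1 hB').2]
  have hT : ∀ B (hB : B ∈ columnBases a),
      T B = (fun z => z + -∑ i ∈ Bᶜ, u B i • a i) ⁻¹' openBox (columnBasis hB) := by
    intro B hB
    ext z
    have hsplit : ∀ x : ι → ℝ, (∀ i, i ∉ B → x i = u B i) → ∑ i, x i • a i =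
        ∑ i : B, x i • columnBasis hB i + ∑ i ∈ Bᶜ, u B i • a i := by
      intro x hx
      rw [← Finset.sum_add_sum_compl B]
      congr 1
      · rw [← Finset.sum_coe_sort B]
        simp
      · exact Finset.sum_congr rfl fun i hi => by rw [hx i (Finset.mem_compl.1 hi)]
    constructor
    · rintro ⟨x, h1, h2, rfl⟩ i
      change 0 < (columnBasis hB).repr (_ + -_) i ∧ (columnBasis hB).repr (_ + -_) i < 1
      rw [hsplit x h2, add_neg_cancel_right, Basis.repr_sum_self]
      exact h1 i i.2
    · intro hz
      refine ⟨fun i => if hi : i ∈ B then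
        (columnBasis hB).repr (z + -∑ i ∈ Bᶜ, u B i • a i) ⟨i, hi⟩ else u B i,
        fun i hi => ?_, fun i hi => by simp [hi], ?_⟩
      · simp only [dif_pos hi]
        exact hz ⟨i, hi⟩
      · rw [hsplit _ fun i hi => by simp [hi]]
        simp only [Finset.coe_mem, dif_pos, Subtype.coe_eta]
        rw [Basis.sum_repr]
        abel
  calc ∑ B ∈ columnBases a, μ (parallelepiped fun i : B => a i)
      = ∑ B ∈ columnBases a, μ (T B) := by
        refine Finset.sum_congr rfl fun B hB => ?_
        rw [hT B hB, measure_preimage_add_right, measure_openBox, coe_columnBasis]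
    _ = μ (⋃ B ∈ columnBases a, T B) := by
        refine (measure_biUnion_finset hdisj fun B hB => ?_).symm
        rw [hT B hB]
        exact ((isOpen_openBox _).preimage (by fun_prop)).measurableSet
    _ ≤ μ (parallelepiped a) := measure_mono (Set.iUnion₂_subset fun B _ => hsub B)

end LowerBound

end ZonotopeVolume

/-! ### Volume and lines in a fixed direction -/

section Slab

variable {E : Type*} [NormedAddCommGroup E] [NormedSpace ℝ E]

/-- The points of the slab `0 ≤ φ < 1` that lie on a line in direction `v` through the interior
of `Z`.  If `φ v = 1`, each such line contributes a half-open segment of the length of `v`, so that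
the volume of this set measures the shadow of `Z` in direction `v`. -/
def shadowSlab (φ : E →L[ℝ] ℝ) (v : E) (Z : Set E) : Set E :=
  {z | φ z ∈ Set.Ico (0 : ℝ) 1 ∧ ∃ s : ℝ, z + s • v ∈ interior Z}

variable (φ : E →L[ℝ] ℝ) {v : E} (hv : φ v = 1) [MeasurableSpace E] [BorelSpace E]

theorem measurableSet_shadowSlab (v : E) (Z : Set E) : MeasurableSet (shadowSlab φ v Z) := by
  have h : shadowSlab φ v Z = φ ⁻¹' Set.Ico 0 1 ∩ ⋃ s : ℝ, (fun z => z + s • v) ⁻¹' interior Z := by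
    ext z; simp [shadowSlab]
  rw [h]
  refine (measurableSet_Ico.preimage φ.measurable).inter (IsOpen.measurableSet ?_)
  exact isOpen_iUnion fun s => isOpen_interior.preimage (by fun_prop)

variable [FiniteDimensional ℝ E] (μ : Measure E) [μ.IsAddHaarMeasure]
include hv

/-- Cavalieri's principle for lines in direction `v`, parametrised by a slab. -/
theorem measure_eq_lintegral_lines {W : Set E} (hW : MeasurableSet W) :
    μ W = ∫⁻ z in φ ⁻¹' Set.Ico 0 1, volume {t : ℝ | z + t • v ∈ W} ∂μ := by
  classical
  have hS : MeasurableSet (φ ⁻¹' Set.Ico (0 : ℝ) 1) := measurableSet_Ico.preimage φ.measurable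
  set S := φ ⁻¹' Set.Ico (0 : ℝ) 1
  have hm : Measurable fun q : E × ℝ => q.1 + q.2 • v := by fun_prop
  have hm' : Measurable fun q : E × ℝ => q.1 + (-q.2) • v := by fun_prop
  calc μ W = ∫⁻ z, W.indicator 1 z ∂μ := by rw [lintegral_indicator_one hW]
    _ = ∫⁻ z, ∫⁻ t : ℝ, W.indicator 1 z * S.indicator 1 (z + (-t) • v) ∂volume ∂μ := by
        refine lintegral_congr fun z => ?_
        rw [lintegral_const_mul _ (by
          exact (measurable_one.indicator hS).comp (by fun_prop))]
        have : (fun t : ℝ => S.indicator (1 : E → ENNReal) (z + (-t) • v)) =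
            (Set.Ioc (φ z - 1) (φ z)).indicator 1 := by
          ext t
          simp only [Set.indicator_apply, S, Set.mem_preimage, map_add, map_smul, hv, Set.mem_Ico,
            Set.mem_Ioc, smul_eq_mul, mul_one, Pi.one_apply]
          refine if_congr ⟨fun h => ?_, fun h => ?_⟩ rfl rfl <;> constructor <;> linarith [h.1, h.2]
        rw [this, lintegral_indicator_one measurableSet_Ioc]
        simp
    _ = ∫⁻ t : ℝ, ∫⁻ z, W.indicator 1 z * S.indicator 1 (z + (-t) • v) ∂μ ∂volume := by
        refine lintegral_lintegral_swap (Measurable.aemeasurable ?_)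
        exact ((measurable_one.indicator hW).comp measurable_fst).mul
          ((measurable_one.indicator hS).comp hm')
    _ = ∫⁻ t : ℝ, ∫⁻ z, W.indicator 1 (z + t • v) * S.indicator 1 z ∂μ ∂volume := by
        refine lintegral_congr fun t => ?_
        rw [← lintegral_add_right_eq_self _ (t • v)]
        simp
    _ = ∫⁻ z, ∫⁻ t : ℝ, W.indicator 1 (z + t • v) * S.indicator 1 z ∂volume ∂μ := by
        refine (lintegral_lintegral_swap (Measurable.aemeasurable ?_)).symm
        exact ((measurable_one.indicator hW).comp hm).mul
          ((measurable_one.indicator hS).comp measurable_fst)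
    _ = ∫⁻ z, S.indicator (fun z => volume {t : ℝ | z + t • v ∈ W}) z ∂μ := by
        refine lintegral_congr fun z => ?_
        rw [lintegral_mul_const _ (by
          exact (measurable_one.indicator hW).comp (by fun_prop))]
        have : ∫⁻ t : ℝ, W.indicator (1 : E → ENNReal) (z + t • v) =
            volume {t : ℝ | z + t • v ∈ W} :=
          lintegral_indicator_one (hW.preimage (by fun_prop : Measurable fun t : ℝ => z + t • v))
        rw [this]
        by_cases hz : z ∈ S <;> simp [hz]
    _ = _ := lintegral_indicator hS _

/-- If every line in direction `v` through the interior of `Z` meets `W` in a set of length at most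
`c`, and no other line meets `W`, then the volume of `W` is at most `c` times that of the shadow. -/
theorem measure_le_mul_shadowSlab {W Z : Set E} (hW : MeasurableSet W) {c : ENNReal}
    (h : ∀ z, volume {t : ℝ | z + t • v ∈ W} ≤ c)
    (h0 : ∀ z ∈ W, ∃ s : ℝ, z + s • v ∈ interior Z) : μ W ≤ c * μ (shadowSlab φ v Z) := by
  rw [measure_eq_lintegral_lines φ hv μ hW, ← lintegral_indicator
    (measurableSet_Ico.preimage φ.measurable)]
  refine (lintegral_mono (g := (shadowSlab φ v Z).indicator fun _ => c) fun z => ?_).trans_eq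
    (lintegral_indicator_const (measurableSet_shadowSlab φ v Z) c)
  by_cases hz : z ∈ shadowSlab φ v Z
  · rw [Set.indicator_of_mem hz]
    exact (Set.indicator_le_self _ _ z).trans (h z)
  · rw [Set.indicator_of_notMem hz, nonpos_iff_eq_zero, Set.indicator_apply_eq_zero]
    intro hzS
    have : {t : ℝ | z + t • v ∈ W} = ∅ := by
      refine Set.eq_empty_iff_forall_notMem.2 fun t ht => hz ⟨hzS, ?_⟩
      obtain ⟨s, hs⟩ := h0 _ ht
      exact ⟨t + s, by rwa [add_smul, ← add_assoc]⟩
    rw [this, measure_empty]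

/-- If every line in direction `v` through the interior of `Z` meets `W` in a set of length at least
`c`, then the volume of `W` is at least `c` times that of the shadow. -/
theorem mul_shadowSlab_le_measure {W Z : Set E} (hW : MeasurableSet W) {c : ENNReal}
    (h : ∀ z ∈ interior Z, c ≤ volume {t : ℝ | z + t • v ∈ W}) :
    c * μ (shadowSlab φ v Z) ≤ μ W := by
  rw [measure_eq_lintegral_lines φ hv μ hW, ← lintegral_indicator
    (measurableSet_Ico.preimage φ.measurable)]
  refine (lintegral_indicator_const (measurableSet_shadowSlab φ v Z) c).symm.trans_le
    (lintegral_mono fun z => ?_)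
  by_cases hz : z ∈ shadowSlab φ v Z
  · rw [Set.indicator_of_mem hz, Set.indicator_of_mem (show z ∈ φ ⁻¹' Set.Ico 0 1 from hz.1)]
    obtain ⟨s, hs⟩ := hz.2
    refine (h _ hs).trans_eq ?_
    have : {t : ℝ | z + s • v + t • v ∈ W} = (fun t => t + s) ⁻¹' {t : ℝ | z + t • v ∈ W} := by
      ext t
      simp only [Set.mem_ofPred_eq, Set.mem_preimage, add_smul]
      rw [add_assoc, add_comm (s • v)]
    rw [this, measure_preimage_add_right]
  · simp [Set.indicator_of_notMem hz]

end Slab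

section ShadowBound

variable {E : Type*} [NormedAddCommGroup E] [NormedSpace ℝ E] {ι : Type*} [Fintype ι]

/-- The bases containing a generator `v` of a zonotope have total volume at most that of the shadow
of the zonotope in direction `v`: compare with the zonotope in which this generator is scaled by a
large factor. -/
theorem sum_measure_parallelepiped_le_shadowSlab [FiniteDimensional ℝ E] [MeasurableSpace E]
    [BorelSpace E] (μ : Measure E) [μ.IsAddHaarMeasure] [DecidableEq ι] (a : ι → E) (b : E) (i : ι)
    (φ : E →L[ℝ] ℝ) (hφ : φ (a i) = 1) (hint : (interior (translatedZonotope a b)).Nonempty) :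
    ∑ B ∈ columnBases a with i ∈ B, μ (parallelepiped fun j : B => a j) ≤
      μ (shadowSlab φ (a i) (translatedZonotope a b)) := by
  classical
  set Z := translatedZonotope a b
  set X := μ (shadowSlab φ (a i) Z)
  set s := ∑ B ∈ columnBases a with i ∈ B, μ (parallelepiped fun j : B => a j) with hs
  obtain ⟨c, hc⟩ : ∃ c : ℕ, ∀ z ∈ Z, -(c : ℝ) ≤ φ z ∧ φ z ≤ c := by
    obtain ⟨c, hc⟩ := ((isCompact_translatedZonotope a b).image φ.continuous).isBounded
      |>.exists_norm_le
    obtain ⟨n, hn⟩ := exists_nat_ge c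
    exact ⟨n, fun z hz => abs_le.1 ((hc _ ⟨z, hz, rfl⟩).trans hn)⟩
  have key : ∀ M : ℕ, ENNReal.ofReal (1 + M) * s ≤ ENNReal.ofReal (2 * c + M) * X := by
    intro M
    have hM : (0 : ℝ) < 1 + M := by positivity
    set a' : ι → E := Function.update a i ((1 + M : ℝ) • a i) with ha'
    have hres : ∀ (B : Finset ι) (hi : i ∈ B), (fun j : B => a' j) =
        Function.update (fun j : B => a j) ⟨i, hi⟩ ((1 + M : ℝ) • a i) := by
      intro B hi
      ext j
      by_cases hj : j = ⟨i, hi⟩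
      · subst hj
        simp [ha']
      · have : (j : ι) ≠ i := fun h => hj (Subtype.ext h)
        simp [ha', hj, this]
    have hbases : ∀ B ∈ columnBases a, B ∈ columnBases a' := by
      intro B hB
      obtain ⟨h1, h2⟩ := mem_columnBases.1 hB
      refine mem_columnBases.2 ⟨?_, h2⟩
      have := h1.units_smul fun j : B => if (j : ι) = i then Units.mk0 (1 + M : ℝ) hM.ne' else 1
      convert this using 1
      ext j
      by_cases hj : (j : ι) = i
      · have : a' j = (1 + M : ℝ) • a j := by rw [hj, ha', Function.update_self]
        rw [Pi.smul_apply', if_pos hj]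
        exact this
      · simp [ha', hj]
    have hvol : ∀ B ∈ columnBases a, i ∈ B → μ (parallelepiped fun j : B => a' j) =
        ENNReal.ofReal (1 + M) * μ (parallelepiped fun j : B => a j) := by
      intro B hB hi
      have := measure_parallelepiped_update (columnBasis hB) μ ⟨i, hi⟩ (1 + M)
      rw [coe_columnBasis] at this
      rw [hres B hi, this, abs_of_pos hM]
    have hsub : ∀ z ∈ translatedZonotope a' b, ∃ w ∈ Z, ∃ t ∈ Set.Icc (0 : ℝ) M,
        z = w + t • a i := by
      rintro z ⟨x, hx, rfl⟩
      refine ⟨b + ∑ j, x j • a j, ⟨x, hx, rfl⟩, M * x i,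
        ⟨by have := (hx i).1; positivity,
          mul_le_of_le_one_right (by positivity) (hx i).2⟩, ?_⟩
      rw [add_assoc, add_right_inj, ← Finset.add_sum_erase _ _ (Finset.mem_univ i),
        ← Finset.add_sum_erase (a := i) _ (fun j => x j • a j) (Finset.mem_univ i)]
      have : ∑ j ∈ Finset.univ.erase i, x j • a' j = ∑ j ∈ Finset.univ.erase i, x j • a j :=
        Finset.sum_congr rfl fun j hj => by
          rw [ha', Function.update_of_ne (Finset.ne_of_mem_erase hj)]
      rw [this, ha', Function.update_self]
      module
    -- a point of the larger interior is a combination of an interior point of `Z` and of a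
    -- translate by a multiple of `a i` of a point of `Z`
    have hline : ∀ z ∈ interior (translatedZonotope a' b), ∃ s : ℝ, z + s • a i ∈ interior Z := by
      intro z hz
      obtain ⟨z₀, hz₀⟩ := hint
      have hcont : Continuous fun ε : ℝ => z + ε • (z - z₀) := by fun_prop
      have hev : ∀ᶠ ε in nhds (0 : ℝ), z + ε • (z - z₀) ∈ translatedZonotope a' b :=
        hcont.continuousAt.preimage_mem_nhds (by simpa using mem_interior_iff_mem_nhds.1 hz)
      obtain ⟨δ, hδ, h⟩ := Metric.eventually_nhds_iff.1 hev
      have hε := h (y := δ / 2) (by rw [Real.dist_eq, sub_zero, abs_of_pos] <;> linarith)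
      set ε := δ / 2
      have hε0 : 0 < ε := by positivity
      obtain ⟨w, hw, t, -, hwt⟩ := hsub _ hε
      refine ⟨-(t / (1 + ε)), ?_⟩
      have hcomb : z + (-(t / (1 + ε))) • a i = (ε / (1 + ε)) • z₀ + (1 / (1 + ε)) • w := by
        have hw' : w = z + ε • (z - z₀) - t • a i := by rw [hwt, add_sub_cancel_right]
        rw [hw']
        match_scalars <;> field_simp
        ring
      rw [hcomb]
      exact (convex_translatedZonotope a b).combo_interior_self_mem_interior hz₀ hw
        (by positivity) (by positivity) (by field_simp; ring)
    calc ENNReal.ofReal (1 + M) * s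
        = ∑ B ∈ columnBases a with i ∈ B, μ (parallelepiped fun j : B => a' j) := by
          rw [hs, Finset.mul_sum]
          refine Finset.sum_congr rfl fun B hB => ?_
          rw [hvol B (Finset.mem_filter.1 hB).1 (Finset.mem_filter.1 hB).2]
      _ ≤ ∑ B ∈ columnBases a', μ (parallelepiped fun j : B => a' j) :=
          Finset.sum_le_sum_of_subset fun B hB => hbases B (Finset.mem_filter.1 hB).1
      _ ≤ μ (parallelepiped a') := sum_measure_parallelepiped_le μ a'
      _ = μ (translatedZonotope a' b) := by
          rw [translatedZonotope_eq_preimage, measure_preimage_add_right]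
      _ ≤ μ (interior (translatedZonotope a' b)) := by
          rw [← add_zero (μ (interior _)),
            ← (convex_translatedZonotope a' b).addHaar_frontier μ]
          refine (measure_mono subset_closure).trans ?_
          rw [closure_eq_interior_union_frontier]
          exact measure_union_le _ _
      _ ≤ ENNReal.ofReal (2 * c + M) * X := by
          refine measure_le_mul_shadowSlab φ hφ μ isOpen_interior.measurableSet (fun z => ?_) hline
          calc volume {t : ℝ | z + t • a i ∈ interior (translatedZonotope a' b)}
              ≤ volume (Set.Icc (-c - φ z) (c + M - φ z)) := by
                refine measure_mono fun t ht => ?_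
                obtain ⟨w, hw, r, hr, hwr⟩ := hsub _ (interior_subset ht)
                have := congrArg φ hwr
                simp only [map_add, map_smul, hφ, smul_eq_mul, mul_one] at this
                have h1 := hc w hw
                constructor <;> linarith [hr.1, hr.2, h1.1, h1.2]
            _ = ENNReal.ofReal (2 * c + M) := by
                rw [Real.volume_Icc]
                ring_nf
  by_contra! hlt
  have hX : X ≠ ⊤ := hlt.ne_top
  have hs' : s ≠ ⊤ := by
    intro h
    have := key 0
    rw [h, ENNReal.mul_top (by simp), top_le_iff] at this
    exact ENNReal.mul_ne_top ENNReal.ofReal_ne_top hX this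
  have hlt' : X.toReal < s.toReal := (ENNReal.toReal_lt_toReal hX hs').2 hlt
  obtain ⟨M, hM⟩ := exists_nat_gt ((2 * c * X.toReal) / (s.toReal - X.toReal))
  rw [div_lt_iff₀ (sub_pos.2 hlt')] at hM
  have h1 := ENNReal.toReal_mono (ENNReal.mul_ne_top ENNReal.ofReal_ne_top hX) (key M)
  rw [ENNReal.toReal_mul, ENNReal.toReal_mul, ENNReal.toReal_ofReal (by positivity),
    ENNReal.toReal_ofReal (by positivity)] at h1
  have : (0 : ℝ) ≤ s.toReal := ENNReal.toReal_nonneg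
  nlinarith

end ShadowBound

/-! ### Face-to-face tilings by parallelepipeds -/

section Tiling

theorem mem_openSegment_smul {E : Type*} [AddCommGroup E] [Module ℝ E] (z v : E) {s t : ℝ}
    (hs : 0 < s) (ht : 0 < t) : z ∈ openSegment ℝ (z + (-s) • v) (z + t • v) := by
  refine ⟨t / (s + t), s / (s + t), by positivity, by positivity, by field_simp; ring, ?_⟩
  match_scalars <;> field_simp <;> ring

variable {E : Type*} [NormedAddCommGroup E] [NormedSpace ℝ E] [FiniteDimensional ℝ E]
  {ι : Type*} [Fintype ι]

/-- A family of parallelepipeds, each spanned by a basis among the vectors `a i` and translated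
to a corner. -/
structure BoxFamily (a : ι → E) (K : Type*) where
  gens : K → Finset ι
  gens_mem : ∀ k, gens k ∈ columnBases a
  corner : K → E

namespace BoxFamily

variable {a : ι → E} {K : Type*} (D : BoxFamily a K)

/-- The basis of the generators of a cell. -/
noncomputable def basis (k : K) : Basis (D.gens k) ℝ E := columnBasis (D.gens_mem k)

theorem basis_apply (k : K) (i : D.gens k) : D.basis k i = a i := columnBasis_apply _ i

/-- The coordinates in which a cell is the unit cube. -/
noncomputable def coord (k : K) (i : D.gens k) (z : E) : ℝ :=
  (D.basis k).repr (z - D.corner k) i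

/-- The parallelepipeds of the family. -/
def cell (k : K) : Set E := {z | ∀ i, 0 ≤ D.coord k i z ∧ D.coord k i z ≤ 1}

/-- The parallelepipeds tile `Z` face to face, and no basis is used twice. -/
structure IsTilingOf (Z : Set E) : Prop where
  gens_injective : Function.Injective D.gens
  iUnion_cell : ⋃ k, D.cell k = Z
  isExtreme : ∀ k k', IsExtreme ℝ (D.cell k) (D.cell k ∩ D.cell k')

theorem coord_add_smul (k : K) (i : D.gens k) (z w : E) (t : ℝ) :
    D.coord k i (z + t • w) = D.coord k i z + t * (D.basis k).repr w i := by
  simp only [coord, add_sub_right_comm, map_add, map_smul, Finsupp.add_apply, Finsupp.smul_apply,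
    smul_eq_mul]

open Classical in
theorem coord_add_smul_gen (k : K) (i j : D.gens k) (z : E) (t : ℝ) :
    D.coord k i (z + t • a j) = D.coord k i z + if i = j then t else 0 := by
  rw [coord_add_smul, ← D.basis_apply, Basis.repr_self, Finsupp.single_apply]
  simp [eq_comm]

theorem coord_add_smul_self (k : K) (i : D.gens k) (z : E) (t : ℝ) :
    D.coord k i (z + t • a i) = D.coord k i z + t := by
  rw [coord_add_smul_gen, if_pos rfl]

theorem coord_add_smul_of_ne (k : K) {i j : D.gens k} (h : i ≠ j) (z : E) (t : ℝ) :
    D.coord k i (z + t • a j) = D.coord k i z := by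
  rw [coord_add_smul_gen, if_neg h, add_zero]

theorem add_smul_mem_cell_iff {k : K} {z : E} (hz : z ∈ D.cell k) (i : D.gens k) (t : ℝ) :
    z + t • a i ∈ D.cell k ↔ -D.coord k i z ≤ t ∧ t ≤ 1 - D.coord k i z := by
  constructor
  · intro h
    have := h i
    rw [coord_add_smul_self] at this
    constructor <;> linarith [this.1, this.2]
  · intro h j
    by_cases hj : j = i
    · subst hj
      rw [coord_add_smul_self]
      constructor <;> linarith [h.1, h.2]
    · rw [coord_add_smul_of_ne _ _ hj]
      exact hz j

theorem continuous_coord (k : K) (i : D.gens k) : Continuous (D.coord k i) :=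
  (continuous_repr_apply (D.basis k) i).comp (continuous_id.sub continuous_const)

theorem isClosed_cell (k : K) : IsClosed (D.cell k) := by
  simp only [cell, Set.ofPred_forall]
  exact isClosed_iInter fun i => (isClosed_le continuous_const (D.continuous_coord k i)).inter
    (isClosed_le (D.continuous_coord k i) continuous_const)

theorem eq_corner_add_sum (k : K) (z : E) :
    z = D.corner k + ∑ i : D.gens k, D.coord k i z • a i := by
  have := (D.basis k).sum_repr (z - D.corner k)
  simp only [D.basis_apply] at this
  simp only [coord, this]
  abel

theorem gen_injective (k : K) {i j : D.gens k} (h : a i = a j) : i = j :=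
  (D.basis k).injective (by rw [D.basis_apply, D.basis_apply, h])

theorem gen_ne_zero (k : K) (i : D.gens k) : a i ≠ 0 := by
  rw [← D.basis_apply]
  exact (D.basis k).ne_zero i

namespace IsTilingOf

variable {D} {Z : Set E} (hD : D.IsTilingOf Z)
include hD

/-- If a point common to two cells can be moved in both directions `± v` in one of them, then these
motions stay in the other one. -/
theorem mem_cell_of_mem_of_mem {k k' : K} {z v : E} (hz : z ∈ D.cell k) (hz' : z ∈ D.cell k')
    {s t : ℝ} (hs : 0 < s) (ht : 0 < t) (h1 : z + (-s) • v ∈ D.cell k)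
    (h2 : z + t • v ∈ D.cell k) : z + (-s) • v ∈ D.cell k' ∧ z + t • v ∈ D.cell k' := by
  have hseg := mem_openSegment_smul z v hs ht
  exact ⟨((hD.isExtreme k k').left_mem_of_mem_openSegment h1 h2 ⟨hz, hz'⟩ hseg).2,
    ((hD.isExtreme k k').left_mem_of_mem_openSegment h2 h1 ⟨hz, hz'⟩
      (by rwa [openSegment_symm])).2⟩

/-- The chord of a cell through a common point in the direction of a generator. -/
theorem chord_mem {k k' : K} {z : E} (hz : z ∈ D.cell k) (hz' : z ∈ D.cell k')
    (i : D.gens k) (h0 : 0 < D.coord k i z) (h1 : D.coord k i z < 1) :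
    z + (-D.coord k i z) • a i ∈ D.cell k' ∧ z + (1 - D.coord k i z) • a i ∈ D.cell k' :=
  hD.mem_cell_of_mem_of_mem hz hz' h0 (by linarith)
    ((D.add_smul_mem_cell_iff hz i _).2 ⟨le_rfl, by linarith⟩)
    ((D.add_smul_mem_cell_iff hz i _).2 ⟨by linarith, le_rfl⟩)

theorem coord_mem_of_repr_ne_zero {k k' : K} {z : E} (hz : z ∈ D.cell k) (hz' : z ∈ D.cell k')
    (i : D.gens k) (h0 : 0 < D.coord k i z) (h1 : D.coord k i z < 1) (j : D.gens k')
    (hj : (D.basis k').repr (a i) j ≠ 0) : 0 < D.coord k' j z ∧ D.coord k' j z < 1 := by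
  obtain ⟨h2, h3⟩ := hD.chord_mem hz hz' i h0 h1
  have h2 := h2 j
  have h3 := h3 j
  rw [coord_add_smul] at h2 h3
  rcases lt_or_gt_of_ne hj with hlt | hlt
  · constructor <;> nlinarith
  · constructor <;> nlinarith

/-- Inside of the common face of two cells, a point can be moved to an edge in the direction of a
given generator of its minimal face. -/
theorem exists_mem_edge {k k' : K} {z : E} (hz : z ∈ D.cell k) (hz' : z ∈ D.cell k')
    (i : D.gens k) (h0 : 0 < D.coord k i z) (h1 : D.coord k i z < 1) :
    ∃ w ∈ D.cell k, w ∈ D.cell k' ∧ (0 < D.coord k i w ∧ D.coord k i w < 1) ∧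
      ∀ j, j ≠ i → D.coord k j w = 0 ∨ D.coord k j w = 1 := by
  classical
  suffices h : ∀ s : Finset (D.gens k), ∃ w ∈ D.cell k, w ∈ D.cell k' ∧
      (0 < D.coord k i w ∧ D.coord k i w < 1) ∧
      ∀ j ∈ s, j ≠ i → D.coord k j w = 0 ∨ D.coord k j w = 1 by
    obtain ⟨w, h1, h2, h3, h4⟩ := h Finset.univ
    exact ⟨w, h1, h2, h3, fun j => h4 j (Finset.mem_univ j)⟩
  intro s
  induction s using Finset.induction_on with
  | empty => exact ⟨z, hz, hz', ⟨h0, h1⟩, by simp⟩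
  | insert j s _ ih =>
    obtain ⟨w, hw, hw', hi, hs⟩ := ih
    by_cases hj : 0 < D.coord k j w ∧ D.coord k j w < 1 ∧ j ≠ i
    · refine ⟨w + (-D.coord k j w) • a j,
        (D.add_smul_mem_cell_iff hw j _).2 ⟨le_rfl, by linarith⟩,
        (hD.chord_mem hw hw' j hj.1 hj.2.1).1, ?_, fun j' hj' hne => ?_⟩
      · rwa [coord_add_smul_of_ne _ _ hj.2.2.symm]
      · by_cases hjj : j' = j
        · subst hjj
          rw [coord_add_smul_self]
          exact Or.inl (by ring)
        · rw [coord_add_smul_of_ne _ _ hjj]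
          exact hs j' (Finset.mem_of_mem_insert_of_ne hj' hjj) hne
    · refine ⟨w, hw, hw', hi, fun j' hj' hne => ?_⟩
      rcases Finset.mem_insert.1 hj' with rfl | hj'
      · have := hw j'
        by_contra! hcon
        exact hj ⟨lt_of_le_of_ne this.1 (Ne.symm hcon.1), lt_of_le_of_ne this.2 hcon.2, hne⟩
      · exact hs j' hj' hne

/-- The generators of the minimal face of a common point of two cells agree up to sign. -/
theorem exists_gen_eq_or_eq_neg {k k' : K} {z : E} (hz : z ∈ D.cell k) (hz' : z ∈ D.cell k')
    (i : D.gens k) (h0 : 0 < D.coord k i z) (h1 : D.coord k i z < 1) :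
    ∃ j : D.gens k', (a j = a i ∨ a j = -a i) ∧ 0 < D.coord k' j z ∧ D.coord k' j z < 1 := by
  classical
  obtain ⟨j, hj⟩ : ∃ j, (D.basis k').repr (a i) j ≠ 0 := by
    by_contra! h
    exact D.gen_ne_zero k i ((D.basis k').repr.map_eq_zero_iff.1 (Finsupp.ext h))
  refine ⟨j, ?_, hD.coord_mem_of_repr_ne_zero hz hz' i h0 h1 j hj⟩
  obtain ⟨w, hw, hw', ⟨hw0, hw1⟩, hedge⟩ := hD.exists_mem_edge hz hz' i h0 h1
  obtain ⟨hj0, hj1⟩ := hD.coord_mem_of_repr_ne_zero hw hw' i hw0 hw1 j hj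
  -- the segment of the second cell through `w` in direction `a j` lies on the edge
  have hline : ∀ x ∈ D.cell k, (∀ i', i' ≠ i → D.coord k i' x = D.coord k i' w) →
      x = w + (D.coord k i x - D.coord k i w) • a i := by
    intro x _ hx
    have e1 := D.eq_corner_add_sum k x
    have e2 := D.eq_corner_add_sum k w
    rw [← Finset.add_sum_erase _ _ (Finset.mem_univ i)] at e1 e2
    rw [Finset.sum_congr rfl fun i' hi' => by rw [hx i' (Finset.ne_of_mem_erase hi')]] at e1
    generalize D.coord k i x = s at e1 ⊢
    generalize D.coord k i w = t at e2 ⊢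
    rw [e1]
    nth_rewrite 2 [e2]
    module
  obtain ⟨hx, hy⟩ := hD.chord_mem hw' hw j hj0 hj1
  set r := D.coord k' j w
  have hxe : ∀ i', i' ≠ i → D.coord k i' (w + (-r) • a j) = D.coord k i' w ∧
      D.coord k i' (w + (1 - r) • a j) = D.coord k i' w := by
    intro i' hi'
    have h1 := hx i'
    have h2 := hy i'
    rw [coord_add_smul] at h1 h2 ⊢
    rw [coord_add_smul]
    rcases hedge i' hi' with he | he <;> rw [he] at h1 h2 ⊢
    · have : (D.basis k).repr (a j) i' = 0 := by nlinarith
      simp [this]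
    · have : (D.basis k).repr (a j) i' = 0 := by nlinarith
      simp [this]
  have ex := hline _ hx fun i' hi' => (hxe i' hi').1
  have ey := hline _ hy fun i' hi' => (hxe i' hi').2
  have bx := hx i
  have bY := hy i
  set s := D.coord k i (w + (-r) • a j)
  set t := D.coord k i (w + (1 - r) • a j)
  have haj : a j = (t - s) • a i := by
    have h3 : (w + (1 - r) • a j) - (w + (-r) • a j) = a j := by module
    rw [← h3]
    nth_rewrite 1 [ey]
    nth_rewrite 1 [ex]
    module
  -- conversely the segment of the first cell lies in the second cell
  obtain ⟨h2, h3⟩ := hD.chord_mem hw hw' i hw0 hw1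
  have h2 := h2 j
  have h3 := h3 j
  rw [coord_add_smul] at h2 h3
  set c := (D.basis k').repr (a i) j
  have hc : (t - s) * c = 1 := by
    have := congrArg (fun y => (D.basis k').repr y j) haj
    simp only [map_smul, Finsupp.smul_apply, smul_eq_mul] at this
    rw [← D.basis_apply, Basis.repr_self, Finsupp.single_eq_same] at this
    exact this.symm
  have hts : t - s = 1 ∨ t - s = -1 := by
    have hc1 : c ≤ 1 := by linarith [h2.1, h3.2]
    have hc2 : -1 ≤ c := by linarith [h2.2, h3.1]
    have hd1 : t - s ≤ 1 := by linarith [bx.1, bY.2]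
    have hd2 : -1 ≤ t - s := by linarith [bx.2, bY.1]
    rcases le_total 0 c with hc0 | hc0
    · left; nlinarith
    · right; nlinarith
  rcases hts with h | h
  · left; rw [haj, h, one_smul]
  · right; rw [haj, h, neg_one_smul]

/-- The generators of the minimal face of a common point of two cells agree, if no two generators
are negatives of each other. -/
theorem exists_gen_eq (hsign : ∀ i j, a i = -a j → a i = 0) {k k' : K} {z : E}
    (hz : z ∈ D.cell k) (hz' : z ∈ D.cell k')
    (i : D.gens k) (h0 : 0 < D.coord k i z) (h1 : D.coord k i z < 1) :
    ∃ j : D.gens k', a j = a i ∧ 0 < D.coord k' j z ∧ D.coord k' j z < 1 := by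
  obtain ⟨j, hj | hj, h⟩ := hD.exists_gen_eq_or_eq_neg hz hz' i h0 h1
  · exact ⟨j, hj, h⟩
  · exact absurd (hsign _ _ hj) (D.gen_ne_zero k' j)

end IsTilingOf

end BoxFamily

end Tiling

/-! ### Zones of a tiling -/

section Zone

variable {E : Type*} [NormedAddCommGroup E] [NormedSpace ℝ E] [FiniteDimensional ℝ E]
  {ι : Type*} [Fintype ι]

namespace BoxFamily

variable {a : ι → E} {K : Type*} (D : BoxFamily a K)

/-- The zone of a vector `v`: the interior points of `Z` at which the minimal face of a cell has
`v` as a generator. -/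
def zone (Z : Set E) (v : E) : Set E :=
  {z | z ∈ interior Z ∧ ∃ k, z ∈ D.cell k ∧
    ∃ i : D.gens k, a i = v ∧ 0 < D.coord k i z ∧ D.coord k i z < 1}

open Classical in
/-- The parameters `α` at which the line `z + ℝ v` enters a cell with generator `v`. -/
noncomputable def entries [Fintype K] (v z : E) : Finset ℝ :=
  Finset.univ.biUnion fun k => ({i : D.gens k | a i = v ∧
    z + (-D.coord k i z) • v ∈ D.cell k} : Finset _).image fun i => -D.coord k i z

theorem mem_entries [Fintype K] {v z : E} {α : ℝ} : α ∈ D.entries v z ↔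
    ∃ k, ∃ i : D.gens k, a i = v ∧ z + α • v ∈ D.cell k ∧ α = -D.coord k i z := by
  simp only [entries, Finset.mem_biUnion, Finset.mem_univ, true_and, Finset.mem_image,
    Finset.mem_filter]
  constructor
  · rintro ⟨k, i, ⟨h1, h2⟩, rfl⟩
    exact ⟨k, i, h1, h2, rfl⟩
  · rintro ⟨k, i, h1, h2, rfl⟩
    exact ⟨k, i, ⟨h1, h2⟩, rfl⟩

/-- The length of the part of the line `z + ℝ v` in the zone of `v` with parameters in `H`. -/
noncomputable def zoneLength (Z : Set E) (v : E) (H : Set ℝ)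
    (z : E) : ℝ :=
  volume.real ({t : ℝ | z + t • v ∈ D.zone Z v} ∩ H)

namespace IsTilingOf

variable {D} {Z : Set E} (hD : D.IsTilingOf Z) (hsign : ∀ i j, a i = -a j → a i = 0)
include hD

theorem cell_subset (k : K) : D.cell k ⊆ Z := by
  rw [← hD.iUnion_cell]
  exact Set.subset_iUnion _ k

theorem add_smul_mem_zone [Fintype K] (hZ : Convex ℝ Z) {v z : E} (hz : z ∈ interior Z) {α : ℝ}
    (hα : α ∈ D.entries v z) {t : ℝ} (ht : t ∈ Set.Ioo α (α + 1)) : z + t • v ∈ D.zone Z v := by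
  obtain ⟨k, i, rfl, hcell, rfl⟩ := D.mem_entries.1 hα
  set r := D.coord k i z
  have hcoord : D.coord k i (z + (-r) • a i) = 0 := by
    rw [coord_add_smul_self]
    exact add_neg_cancel r
  have hmem : ∀ t ∈ Set.Icc (-r) (-r + 1), z + t • a i ∈ D.cell k := by
    intro t ht
    have := (D.add_smul_mem_cell_iff hcell i (t + r)).2
      (by rw [hcoord]; constructor <;> linarith [ht.1, ht.2])
    rwa [add_assoc, ← add_smul, neg_add_cancel_comm_assoc] at this
  refine ⟨?_, k, hmem t ⟨ht.1.le, ht.2.le⟩, i, rfl, ?_⟩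
  · -- `z + t v` lies strictly between the interior point `z` and an end of the chord of the cell
    have key : ∀ s : ℝ, s ∈ Set.Icc (-r) (-r + 1) → ∀ θ : ℝ, 0 ≤ θ → θ < 1 → t = θ * s →
        z + t • a i ∈ interior Z := by
      intro s hs θ h0 h1 hts
      have := hZ.combo_interior_self_mem_interior hz (hD.cell_subset k (hmem s hs))
        (a := 1 - θ) (b := θ) (by linarith) h0 (by ring)
      convert this using 1
      rw [hts]
      module
    rcases lt_trichotomy t 0 with h | h | h
    · refine key (-r) ⟨le_rfl, by linarith⟩ (t / -r)
        (div_nonneg_of_nonpos h.le (by linarith [ht.1])) ?_ ?_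
      · rw [div_lt_one_of_neg (by linarith [ht.1])]
        exact ht.1
      · have : -r ≠ 0 := by linarith [ht.1]
        exact (div_mul_cancel₀ t this).symm
    · simpa [h] using hz
    · refine key (-r + 1) ⟨by linarith, le_rfl⟩ (t / (-r + 1))
        (div_nonneg h.le (by linarith [ht.2])) ?_ ?_
      · rw [div_lt_one (by linarith [ht.2])]
        exact ht.2
      · have : -r + 1 ≠ 0 := by linarith [ht.2]
        field_simp
  · rw [coord_add_smul_self]
    constructor <;> linarith [ht.1, ht.2]

/-- A line in direction `v` through an interior point meets the zone of `v` in the unit intervals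
that begin at its entries. -/
theorem add_smul_mem_zone_iff [Fintype K] (hZ : Convex ℝ Z) {v z : E} (hz : z ∈ interior Z)
    {t : ℝ} : z + t • v ∈ D.zone Z v ↔ ∃ α ∈ D.entries v z, t ∈ Set.Ioo α (α + 1) := by
  refine ⟨?_, fun ⟨α, hα, ht⟩ => hD.add_smul_mem_zone hZ hz hα ht⟩
  rintro ⟨_, k, hk, i, rfl, h0, h1⟩
  rw [coord_add_smul_self] at h0 h1
  refine ⟨-D.coord k i z, D.mem_entries.2 ⟨k, i, rfl, ?_, rfl⟩, by linarith, by linarith⟩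
  have := (D.add_smul_mem_cell_iff hk i (-D.coord k i z - t)).2
    (by rw [coord_add_smul_self]; constructor <;> linarith)
  rwa [add_assoc, ← add_smul, add_sub_cancel] at this

include hsign

theorem exists_gen_of_mem_zone {v z : E} (hz : z ∈ D.zone Z v) {k : K} (hk : z ∈ D.cell k) :
    ∃ i : D.gens k, a i = v ∧ 0 < D.coord k i z ∧ D.coord k i z < 1 := by
  obtain ⟨_, k', hk', i, rfl, h0, h1⟩ := hz
  exact hD.exists_gen_eq hsign hk' hk i h0 h1

theorem notMem_zone {v z : E} {k : K} (hk : z ∈ D.cell k) (i : D.gens k) (hi : a i = v)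
    (h : D.coord k i z = 0 ∨ D.coord k i z = 1) : z ∉ D.zone Z v := by
  intro hz
  obtain ⟨j, hj, h0, h1⟩ := hD.exists_gen_of_mem_zone hsign hz hk
  obtain rfl := D.gen_injective k (hi.trans hj.symm)
  rcases h with h | h <;> rw [h] at h0 h1 <;> linarith

theorem isOpen_zone [Finite K] (v : E) : IsOpen (D.zone Z v) := by
  have h : D.zone Z v = interior Z ∩ (⋃ k, D.cell k ∩ ⋂ i : D.gens k, ⋂ _ : a i = v,
      {z | D.coord k i z = 0} ∪ {z | D.coord k i z = 1})ᶜ := by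
    ext z
    simp only [Set.mem_inter_iff, Set.mem_compl_iff, Set.mem_iUnion, Set.mem_iInter, not_exists,
      not_and, Set.mem_union, Set.mem_ofPred_eq, not_forall]
    constructor
    · intro hz
      refine ⟨hz.1, fun k hk => ?_⟩
      obtain ⟨i, hi, h0, h1⟩ := hD.exists_gen_of_mem_zone hsign hz hk
      exact ⟨i, hi, not_or.2 ⟨h0.ne', h1.ne⟩⟩
    · rintro ⟨hz, h⟩
      obtain ⟨k, hk⟩ := Set.mem_iUnion.1 (hD.iUnion_cell.symm ▸ interior_subset hz)
      obtain ⟨i, hi, hne⟩ := h k hk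
      rw [not_or] at hne
      exact ⟨hz, k, hk, i, hi, lt_of_le_of_ne (hk i).1 (Ne.symm hne.1),
        lt_of_le_of_ne (hk i).2 hne.2⟩
  rw [h]
  refine isOpen_interior.inter (isClosed_iUnion_of_finite fun k => ?_).isOpen_compl
  refine (D.isClosed_cell k).inter (isClosed_iInter fun i => isClosed_iInter fun _ => ?_)
  exact (isClosed_eq (D.continuous_coord k i) continuous_const).union
    (isClosed_eq (D.continuous_coord k i) continuous_const)

theorem entry_add_smul_notMem_zone [Fintype K] {v z : E} {α : ℝ} (hα : α ∈ D.entries v z) :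
    z + α • v ∉ D.zone Z v ∧ z + (α + 1) • v ∉ D.zone Z v := by
  obtain ⟨k, i, rfl, hcell, rfl⟩ := D.mem_entries.1 hα
  have hcoord : D.coord k i (z + (-D.coord k i z) • a i) = 0 := by
    rw [coord_add_smul_self]
    exact add_neg_cancel _
  refine ⟨hD.notMem_zone hsign hcell i rfl (Or.inl hcoord), ?_⟩
  have h := (D.add_smul_mem_cell_iff hcell i 1).2 (by rw [hcoord]; constructor <;> linarith)
  rw [add_assoc, ← add_smul] at h
  refine hD.notMem_zone hsign h i rfl (Or.inr ?_)
  rw [coord_add_smul_self]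
  ring

theorem entries_separated [Fintype K] (hZ : Convex ℝ Z) {v z : E} (hz : z ∈ interior Z)
    {α β : ℝ} (hα : α ∈ D.entries v z) (hβ : β ∈ D.entries v z) (h : α < β) : α + 1 ≤ β := by
  by_contra! hlt
  exact (hD.entry_add_smul_notMem_zone hsign hβ).1
    (hD.add_smul_mem_zone hZ hz hα ⟨h, hlt⟩)

theorem pairwiseDisjoint_entries [Fintype K] (hZ : Convex ℝ Z) {v z : E} (hz : z ∈ interior Z) :
    (D.entries v z : Set ℝ).PairwiseDisjoint fun α => Set.Ioo α (α + 1) := by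
  intro α hα β hβ hne
  refine Set.disjoint_left.2 fun t h1 h2 => ?_
  rcases lt_or_gt_of_ne hne with h | h
  · linarith [hD.entries_separated hsign hZ hz hα hβ h, h1.2, h2.1]
  · linarith [hD.entries_separated hsign hZ hz hβ hα h, h1.1, h2.2]

theorem zoneLength_eq_sum [Fintype K] (hZ : Convex ℝ Z) {v z : E} (hz : z ∈ interior Z)
    {H : Set ℝ} (hH : MeasurableSet H) :
    D.zoneLength Z v H z = ∑ α ∈ D.entries v z, volume.real (Set.Ioo α (α + 1) ∩ H) := by
  have h : {t : ℝ | z + t • v ∈ D.zone Z v} ∩ H =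
      ⋃ α ∈ D.entries v z, Set.Ioo α (α + 1) ∩ H := by
    ext t
    simp only [Set.mem_inter_iff, Set.mem_ofPred_eq, hD.add_smul_mem_zone_iff hZ hz,
      Set.mem_iUnion]
    tauto
  rw [zoneLength, h, measureReal_biUnion_finset
    (fun α hα β hβ hne => (hD.pairwiseDisjoint_entries hsign hZ hz hα hβ hne).mono
      Set.inter_subset_left Set.inter_subset_left)
    (fun α _ => measurableSet_Ioo.inter hH)
    (fun α _ => ((measure_mono Set.inter_subset_left).trans_lt measure_Ioo_lt_top).ne)]

/-- The total length of a line in the zone counts its entries. -/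
theorem volume_line_inter_zone [Fintype K] (hZ : Convex ℝ Z) {v z : E} (hz : z ∈ interior Z) :
    volume {t : ℝ | z + t • v ∈ D.zone Z v} = (D.entries v z).card := by
  have h : {t : ℝ | z + t • v ∈ D.zone Z v} = ⋃ α ∈ D.entries v z, Set.Ioo α (α + 1) := by
    ext t
    simp only [Set.mem_ofPred_eq, hD.add_smul_mem_zone_iff hZ hz, Set.mem_iUnion,
      exists_prop]
  rw [h, measure_biUnion_finset (hD.pairwiseDisjoint_entries hsign hZ hz)
    fun _ _ => measurableSet_Ioo]
  simp

/-- The length of the zone along lines is continuous on the interior: apart from finitely many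
parameters and the boundary, the points near a point of the zone belong to the zone, and the points
near a point outside of it do not. -/
theorem continuousAt_zoneLength [Fintype K] (hZ : Convex ℝ Z) (hZc : IsCompact Z) {v z₀ : E}
    (hv : v ≠ 0) (hz₀ : z₀ ∈ interior Z) {H : Set ℝ} (hH : MeasurableSet H) :
    ContinuousAt (D.zoneLength Z v H) z₀ := by
  classical
  set W := D.zone Z v
  have hW : IsOpen W := hD.isOpen_zone hsign v
  have hline : ∀ z : E, Continuous fun t : ℝ => z + t • v := fun z => by fun_prop
  have hmeas : ∀ z : E, MeasurableSet ({t : ℝ | z + t • v ∈ W} ∩ H) := fun z =>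
    (hW.preimage (hline z)).measurableSet.inter hH
  have hrw : D.zoneLength Z v H =
      fun z => ∫ t, ({t : ℝ | z + t • v ∈ W} ∩ H).indicator (1 : ℝ → ℝ) t := by
    ext z
    rw [integral_indicator_one (hmeas z)]
    rfl
  rw [hrw]
  obtain ⟨r, hr⟩ := hZc.isBounded.exists_norm_le
  set ρ := (r + (‖z₀‖ + 1)) / ‖v‖
  have hbd : ∀ z ∈ Metric.ball z₀ 1, ∀ t : ℝ, z + t • v ∈ W → t ∈ Set.Icc (-ρ) ρ := by
    intro z hz t ht
    have h1 : ‖z + t • v‖ ≤ r := hr _ (interior_subset ht.1)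
    have h2 : ‖z‖ ≤ ‖z₀‖ + 1 := by
      have := norm_le_norm_add_norm_sub' z z₀
      rw [Metric.mem_ball, dist_eq_norm] at hz
      linarith
    have h3 : ‖t • v‖ ≤ r + (‖z₀‖ + 1) := by
      have := norm_sub_le (z + t • v) z
      rw [add_sub_cancel_left] at this
      linarith
    rw [norm_smul, Real.norm_eq_abs] at h3
    exact abs_le.1 ((le_div_iff₀ (norm_pos_iff.2 hv)).2 h3)
  refine continuousAt_of_dominated (bound := (Set.Icc (-ρ) ρ).indicator 1) ?_ ?_ ?_ ?_
  · exact Filter.Eventually.of_forall fun z =>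
      (measurable_one.indicator (hmeas z)).aestronglyMeasurable
  · filter_upwards [Metric.ball_mem_nhds z₀ one_pos] with z hz
    refine Filter.Eventually.of_forall fun t => ?_
    by_cases ht : t ∈ {t : ℝ | z + t • v ∈ W} ∩ H
    · rw [Set.indicator_of_mem ht, Set.indicator_of_mem (hbd z hz t ht.1)]
      simp
    · rw [Set.indicator_of_notMem ht, norm_zero]
      exact Set.indicator_nonneg (fun _ _ => zero_le_one) t
  · exact (integrable_indicator_iff measurableSet_Icc).2
      (integrableOn_const (C := (1 : ℝ)) (by simp))
  · set J : Set ℝ := {t | z₀ + t • v ∈ Z}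
    have hJ : Convex ℝ J := by
      intro s hs t ht p q hp hq hpq
      have := hZ hs ht hp hq hpq
      change z₀ + (p • s + q • t) • v ∈ Z
      convert this using 1
      have : z₀ = (p + q) • z₀ := by rw [hpq, one_smul]
      nth_rewrite 1 [this]
      simp only [smul_eq_mul]
      module
    have hfin : (⋃ k, ⋃ i : D.gens k, ({-D.coord k i z₀, 1 - D.coord k i z₀} : Set ℝ)).Finite :=
      Set.finite_iUnion fun k => Set.finite_iUnion fun i => Set.toFinite _
    filter_upwards [compl_mem_ae_iff.2 (hJ.addHaar_frontier volume),
      compl_mem_ae_iff.2 (hfin.measure_zero volume)] with t htJ ht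
    by_cases htH : t ∈ H
    swap
    · have : ∀ z : E, ({t : ℝ | z + t • v ∈ W} ∩ H).indicator (1 : ℝ → ℝ) t = 0 := fun z =>
        Set.indicator_of_notMem (fun h => htH h.2) _
      simp only [this]
      exact continuousAt_const
    have hcont : Continuous fun z : E => z + t • v := by fun_prop
    have htend : Filter.Tendsto (fun z : E => z + t • v) (nhds z₀) (nhds (z₀ + t • v)) :=
      hcont.continuousAt
    by_cases hp : z₀ + t • v ∈ W
    · have : ∀ᶠ z in nhds z₀,
          ({t : ℝ | z + t • v ∈ W} ∩ H).indicator (1 : ℝ → ℝ) t = 1 := by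
        filter_upwards [htend (hW.mem_nhds hp)] with z hz
        have hmem : t ∈ {t : ℝ | z + t • v ∈ W} ∩ H := ⟨hz, htH⟩
        rw [Set.indicator_of_mem hmem, Pi.one_apply]
      exact (continuousAt_congr this).2 continuousAt_const
    · have hev : ∀ᶠ p in nhds (z₀ + t • v), p ∉ W := by
        by_cases hpZ : z₀ + t • v ∈ Z
        · have hpint : z₀ + t • v ∈ interior Z := by
            have htJ' : t ∈ interior J := by
              by_contra h
              exact htJ ⟨subset_closure hpZ, h⟩
            -- the parameter can be enlarged, so that the point is between `z₀` and a point of `Z`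
            have hcs : ContinuousAt (fun θ : ℝ => t * (1 + θ)) 0 := by fun_prop
            have hcs' : Filter.Tendsto (fun θ : ℝ => t * (1 + θ)) (nhds 0) (nhds t) := by
              simpa [ContinuousAt] using hcs
            obtain ⟨δ, hδ, h⟩ := Metric.eventually_nhds_iff.1
              (hcs' (mem_interior_iff_mem_nhds.1 htJ'))
            have hθ := h (y := δ / 2) (by rw [Real.dist_eq, sub_zero, abs_of_pos] <;> linarith)
            set θ := δ / 2
            have hθ0 : 0 < θ := by positivity
            have := hZ.combo_interior_self_mem_interior hz₀ hθ (a := θ / (1 + θ))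
              (b := 1 / (1 + θ)) (by positivity) (by positivity) (by field_simp; ring)
            convert this using 1
            match_scalars <;> field_simp
            ring
          have hk : ∀ k, ∀ᶠ p in nhds (z₀ + t • v), p ∈ D.cell k →
              ∀ i : D.gens k, a i ≠ v := by
            intro k
            by_cases hpk : z₀ + t • v ∈ D.cell k
            · refine Filter.Eventually.of_forall fun p _ i hi => hp ?_
              refine ⟨hpint, k, hpk, i, hi, ?_⟩
              have h1 := hpk i
              have h2 : t ≠ -D.coord k i z₀ ∧ t ≠ 1 - D.coord k i z₀ := by
                simp only [Set.mem_compl_iff, Set.mem_iUnion, not_exists, Set.mem_insert_iff,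
                  Set.mem_singleton_iff, not_or] at ht
                exact ht k i
              rw [← hi, coord_add_smul_self] at h1 ⊢
              exact ⟨lt_of_le_of_ne h1.1 fun h => h2.1 (by linarith),
                lt_of_le_of_ne h1.2 fun h => h2.2 (by linarith)⟩
            · filter_upwards [(D.isClosed_cell k).isOpen_compl.mem_nhds hpk] with p hp' h
              exact absurd h hp'
          filter_upwards [Filter.eventually_all.2 hk] with p hp'
          rintro ⟨_, k, hk, i, hi, _⟩
          exact hp' k hk i hi
        · filter_upwards [hZc.isClosed.isOpen_compl.mem_nhds hpZ] with p hp' h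
          exact hp' (interior_subset h.1)
      have : ∀ᶠ z in nhds z₀,
          ({t : ℝ | z + t • v ∈ W} ∩ H).indicator (1 : ℝ → ℝ) t = 0 := by
        filter_upwards [htend hev] with z hz
        exact Set.indicator_of_notMem (fun h => hz h.1) _
      exact (continuousAt_congr this).2 continuousAt_const

end IsTilingOf

end BoxFamily

end Zone

/-! ### Counting the crossings of a zone -/

section Corner

/-- A continuous function with finitely many values is constant on preconnected sets. -/
theorem IsPreconnected.eq_of_finite_image {X Y : Type*} [TopologicalSpace X] [MetricSpace Y]
    {s : Set X} (hs : IsPreconnected s) {f : X → Y} (hf : ContinuousOn f s)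
    (hfin : (f '' s).Finite) {x y : X} (hx : x ∈ s) (hy : y ∈ s) : f x = f y :=
  hfin.countable.isTotallyDisconnected _ subset_rfl (hs.image f hf) ⟨x, hx, rfl⟩ ⟨y, hy, rfl⟩

variable {E : Type*} [NormedAddCommGroup E] [NormedSpace ℝ E] [FiniteDimensional ℝ E]
  {ι : Type*} [Fintype ι]

namespace BoxFamily

variable {a : ι → E} {K : Type*} (D : BoxFamily a K)

theorem cell_eq_preimage (k : K) : D.cell k =
    (fun z => z + -D.corner k) ⁻¹' parallelepiped (fun i : D.gens k => a i) := by
  rw [← coe_columnBasis (D.gens_mem k), parallelepiped_basis_eq_setOf]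
  ext z
  simp only [cell, coord, Set.mem_preimage, Set.mem_ofPred_eq, sub_eq_add_neg]
  rfl

theorem exists_coord_eq_half (k : K) : ∃ z ∈ interior (D.cell k),
    ∀ i, D.coord k i z = 1 / 2 := by
  set z := D.corner k + ∑ i : D.gens k, (1 / 2 : ℝ) • D.basis k i with hz
  have hc : ∀ i, D.coord k i z = 1 / 2 := by
    intro i
    rw [coord, hz, add_sub_cancel_left, Basis.repr_sum_self]
  refine ⟨z, ?_, hc⟩
  have hopen : IsOpen (⋂ i : D.gens k, {z | 0 < D.coord k i z ∧ D.coord k i z < 1}) :=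
    isOpen_iInter_of_finite fun i => (isOpen_lt continuous_const (D.continuous_coord k i)).inter
      (isOpen_lt (D.continuous_coord k i) continuous_const)
  refine mem_interior.2 ⟨_, fun w hw i => ?_, hopen, Set.mem_iInter.2 fun i => ?_⟩
  · have := Set.mem_iInter.1 hw i
    exact ⟨this.1.le, this.2.le⟩
  · change 0 < D.coord k i z ∧ D.coord k i z < 1
    rw [hc]
    norm_num

namespace IsTilingOf

variable {D} {Z : Set E} (hD : D.IsTilingOf Z)
include hD

/-- The zone of `v` has volume at most the number of generators equal to `v` times the volume of
the shadow of `Z` in direction `v`, because each basis belongs to at most one tile. -/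
theorem measure_zone_le [Fintype K] [MeasurableSpace E] [BorelSpace E] (μ : Measure E)
    [μ.IsAddHaarMeasure] [DecidableEq E] {b : E} (hZ : Z = translatedZonotope a b)
    (hint : (interior Z).Nonempty) {v : E} (φ : E →L[ℝ] ℝ) (hφ : φ v = 1) :
    μ (D.zone Z v) ≤ (Finset.univ.filter fun i => a i = v).card * μ (shadowSlab φ v Z) := by
  classical
  calc μ (D.zone Z v)
      ≤ μ (⋃ i ∈ Finset.univ.filter fun i => a i = v,
          ⋃ k ∈ Finset.univ.filter fun k => i ∈ D.gens k, D.cell k) := by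
        refine measure_mono ?_
        rintro z ⟨_, k, hk, i, hi, _⟩
        simp only [Set.mem_iUnion, Finset.mem_filter, Finset.mem_univ, true_and]
        exact ⟨i, hi, k, i.2, hk⟩
    _ ≤ ∑ i with a i = v, ∑ k with i ∈ D.gens k, μ (D.cell k) :=
        (measure_biUnion_finset_le _ _).trans
          (Finset.sum_le_sum fun i _ => measure_biUnion_finset_le _ _)
    _ = ∑ i with a i = v, ∑ k with i ∈ D.gens k,
          μ (parallelepiped fun j : D.gens k => a j) := by
        simp only [cell_eq_preimage, measure_preimage_add_right]
    _ = ∑ i with a i = v, ∑ B ∈ (Finset.univ.filter fun k => i ∈ D.gens k).image D.gens,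
          μ (parallelepiped fun j : B => a j) := by
        refine Finset.sum_congr rfl fun i _ => ?_
        rw [Finset.sum_image fun k _ k' _ h => hD.gens_injective h]
    _ ≤ ∑ i with a i = v, ∑ B ∈ columnBases a with i ∈ B,
          μ (parallelepiped fun j : B => a j) := by
        refine Finset.sum_le_sum fun i _ => Finset.sum_le_sum_of_subset fun B hB => ?_
        obtain ⟨k, hk, rfl⟩ := Finset.mem_image.1 hB
        exact Finset.mem_filter.2 ⟨D.gens_mem k, (Finset.mem_filter.1 hk).2⟩
    _ ≤ ∑ i with a i = v, μ (shadowSlab φ v Z) := by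
        refine Finset.sum_le_sum fun i hi => ?_
        obtain rfl := (Finset.mem_filter.1 hi).2
        subst hZ
        exact sum_measure_parallelepiped_le_shadowSlab μ a b i φ hφ hint
    _ = _ := by rw [Finset.sum_const, nsmul_eq_mul]

variable (hsign : ∀ i j, a i = -a j → a i = 0)
include hsign

/-- All lines in direction `v` through the interior meet the zone of `v` equally often. -/
theorem exists_card_entries_eq [Fintype K] (hZ : Convex ℝ Z) (hZc : IsCompact Z) {v : E}
    (hv : v ≠ 0) : ∃ n : ℕ, ∀ z ∈ interior Z, (D.entries v z).card = n := by
  classical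
  rcases (interior Z).eq_empty_or_nonempty with h | ⟨z₀, hz₀⟩
  · exact ⟨0, by simp [h]⟩
  refine ⟨(D.entries v z₀).card, fun z hz => ?_⟩
  have hval : ∀ z ∈ interior Z, D.zoneLength Z v Set.univ z = (D.entries v z).card := by
    intro z hz
    rw [zoneLength, Set.inter_univ, measureReal_def, hD.volume_line_inter_zone hsign hZ hz]
    simp
  have hcont : ContinuousOn (D.zoneLength Z v Set.univ) (interior Z) := fun z hz =>
    (hD.continuousAt_zoneLength hsign hZ hZc hv hz MeasurableSet.univ).continuousWithinAt
  have hbound : ∀ z, (D.entries v z).card ≤ ∑ k, Fintype.card (D.gens k) := by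
    intro z
    refine Finset.card_biUnion_le.trans (Finset.sum_le_sum fun k _ => ?_)
    exact Finset.card_image_le.trans (Finset.card_le_univ _)
  have hfin : (D.zoneLength Z v Set.univ '' interior Z).Finite := by
    refine ((Finset.range (∑ k, Fintype.card (D.gens k) + 1)).finite_toSet.image
      (Nat.cast : ℕ → ℝ)).subset ?_
    rintro _ ⟨z, hz, rfl⟩
    exact ⟨_, Finset.mem_coe.2 (Finset.mem_range.2 (Nat.lt_succ_of_le (hbound z))),
      (hval z hz).symm⟩
  have := hZ.interior.isPreconnected.eq_of_finite_image hcont hfin hz hz₀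
  rw [hval z hz, hval z₀ hz₀] at this
  exact_mod_cast this

/-- The number of times that a line in direction `v` meets the zone of `v` is at most the number of
generators equal to `v`. -/
theorem card_entries_le [Fintype K] [DecidableEq E] {b : E} (hZ : Z = translatedZonotope a b)
    {v : E} (hv : v ≠ 0) {z : E} (hz : z ∈ interior Z) :
    (D.entries v z).card ≤ (Finset.univ.filter fun i => a i = v).card := by
  borelize E
  set μ : Measure E := Measure.addHaar
  have hconv : Convex ℝ Z := hZ ▸ convex_translatedZonotope a b
  have hcomp : IsCompact Z := hZ ▸ isCompact_translatedZonotope a b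
  obtain ⟨φ, hφ⟩ := SeparatingDual.exists_eq_one (R := ℝ) hv
  obtain ⟨n, hn⟩ := hD.exists_card_entries_eq hsign hconv hcomp hv
  set X := μ (shadowSlab φ v Z)
  have h1 : (n : ENNReal) * X ≤ (Finset.univ.filter fun i => a i = v).card * X := by
    refine (mul_shadowSlab_le_measure φ hφ μ (hD.isOpen_zone hsign v).measurableSet
      fun w hw => ?_).trans (hD.measure_zone_le μ hZ ⟨z, hz⟩ φ hφ)
    rw [hD.volume_line_inter_zone hsign hconv hw, hn w hw]
  have hpos : X ≠ 0 := by
    have hopen : IsOpen {w : E | (0 < φ w ∧ φ w < 1) ∧ ∃ s : ℝ, w + s • v ∈ interior Z} := by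
      have : {w : E | (0 < φ w ∧ φ w < 1) ∧ ∃ s : ℝ, w + s • v ∈ interior Z} =
          {w | 0 < φ w ∧ φ w < 1} ∩ ⋃ s : ℝ, (fun w => w + s • v) ⁻¹' interior Z := by
        ext; simp
      rw [this]
      exact ((isOpen_lt continuous_const φ.continuous).inter
        (isOpen_lt φ.continuous continuous_const)).inter
        (isOpen_iUnion fun s => isOpen_interior.preimage (by fun_prop))
    have hne : {w : E | (0 < φ w ∧ φ w < 1) ∧ ∃ s : ℝ, w + s • v ∈ interior Z}.Nonempty := by
      refine ⟨z + (1 / 2 - φ z) • v, ⟨?_, ?_⟩, φ z - 1 / 2, ?_⟩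
      · rw [map_add, map_smul, hφ, smul_eq_mul]; linarith
      · rw [map_add, map_smul, hφ, smul_eq_mul]; linarith
      · convert hz using 1
        module
    have hsub : {w : E | (0 < φ w ∧ φ w < 1) ∧ ∃ s : ℝ, w + s • v ∈ interior Z} ⊆
        shadowSlab φ v Z := fun w hw => ⟨⟨hw.1.1.le, hw.1.2⟩, hw.2⟩
    exact ((hopen.measure_pos μ hne).trans_le (measure_mono hsub)).ne'
  rw [hn z hz]
  by_cases htop : X = ⊤
  · -- the zone is bounded, so that an infinite shadow would not be met at all
    have hfin : μ (D.zone Z v) ≠ ⊤ :=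
      ((measure_mono fun w hw => interior_subset hw.1).trans_lt hcomp.measure_lt_top).ne
    have h2 : (n : ENNReal) * X ≤ μ (D.zone Z v) :=
      mul_shadowSlab_le_measure φ hφ μ (hD.isOpen_zone hsign v).measurableSet fun w hw => by
        rw [hD.volume_line_inter_zone hsign hconv hw, hn w hw]
    rcases Nat.eq_zero_or_pos n with h | h
    · omega
    · rw [htop, ENNReal.mul_top (by exact_mod_cast h.ne'), top_le_iff] at h2
      exact absurd h2 hfin
  · exact_mod_cast (ENNReal.mul_le_mul_iff_left hpos htop).1 h1

/-- On a cell, the length of the zone of `v` below a point is an integer plus the coordinate that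
belongs to `v`, if `v` is a generator of the cell, and an integer otherwise. -/
theorem exists_zoneLength_eq [Fintype K] [DecidableEq E] (hZ : Convex ℝ Z) {v z : E}
    (hz : z ∈ interior Z) {k : K} (hk : z ∈ D.cell k) :
    ∃ m : ℕ, D.zoneLength Z v (Set.Iio 0) z = m +
      ∑ i ∈ Finset.univ.filter fun i : D.gens k => a i = v, D.coord k i z ∧
      m + (Finset.univ.filter fun i : D.gens k => a i = v).card ≤ (D.entries v z).card := by
  classical
  rw [hD.zoneLength_eq_sum hsign hZ hz measurableSet_Iio]
  have hbelow : ∀ α : ℝ, α + 1 ≤ 0 → volume.real (Set.Ioo α (α + 1) ∩ Set.Iio 0) = 1 := by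
    intro α hα
    have : Set.Ioo α (α + 1) ∩ Set.Iio 0 = Set.Ioo α (α + 1) :=
      Set.inter_eq_left.2 fun t ht => Set.mem_Iio.2 (lt_of_lt_of_le ht.2 hα)
    rw [this]
    simp
  have habove : ∀ α : ℝ, 0 ≤ α → volume.real (Set.Ioo α (α + 1) ∩ Set.Iio 0) = 0 := by
    intro α hα
    have : Set.Ioo α (α + 1) ∩ Set.Iio 0 = ∅ :=
      Set.eq_empty_iff_forall_notMem.2 fun t ht => by
        have h1 := ht.1.1
        have h2 : t < 0 := ht.2
        linarith
    rw [this]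
    simp
  have hcount : ∀ s : Finset ℝ, (∀ α ∈ s, α + 1 ≤ 0 ∨ 0 ≤ α) →
      ∑ α ∈ s, volume.real (Set.Ioo α (α + 1) ∩ Set.Iio 0) =
        (s.filter fun α => α + 1 ≤ 0).card := by
    intro s hs
    rw [Finset.card_filter, Nat.cast_sum]
    refine Finset.sum_congr rfl fun α hα => ?_
    by_cases h : α + 1 ≤ 0
    · rw [hbelow α h, if_pos h, Nat.cast_one]
    · rw [habove α ((hs α hα).resolve_left h), if_neg h, Nat.cast_zero]
  by_cases hex : ∃ i : D.gens k, a i = v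
  · obtain ⟨i, hi⟩ := hex
    have hfilter : (Finset.univ.filter fun j : D.gens k => a j = v) = {i} := by
      ext j
      simp only [Finset.mem_filter, Finset.mem_univ, true_and, Finset.mem_singleton]
      exact ⟨fun hj => D.gen_injective k (hj.trans hi.symm), fun hj => hj ▸ hi⟩
    have hα : -D.coord k i z ∈ D.entries v z := by
      refine D.mem_entries.2 ⟨k, i, hi, ?_, rfl⟩
      rw [← hi]
      exact (D.add_smul_mem_cell_iff hk i _).2 ⟨le_rfl, by linarith [(hk i).2]⟩
    rw [hfilter, Finset.sum_singleton, Finset.card_singleton, ← Finset.sum_erase_add _ _ hα,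
      hcount]
    · refine ⟨(((D.entries v z).erase (-D.coord k i z)).filter fun α => α + 1 ≤ 0).card, ?_, ?_⟩
      · congr 1
        have h0 := (hk i).1
        have h1 := (hk i).2
        have : Set.Ioo (-D.coord k i z) (-D.coord k i z + 1) ∩ Set.Iio 0 =
            Set.Ioo (-D.coord k i z) 0 := by
          ext t
          simp only [Set.mem_inter_iff, Set.mem_Ioo, Set.mem_Iio]
          constructor
          · exact fun h => ⟨h.1.1, h.2⟩
          · exact fun h => ⟨⟨h.1, by linarith [h.2]⟩, h.2⟩
        rw [this, Real.volume_real_Ioo_of_le (by linarith)]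
        ring
      · have := Finset.card_filter_le ((D.entries v z).erase (-D.coord k i z))
          fun α => α + 1 ≤ 0
        have := Finset.card_erase_add_one hα
        omega
    · intro β hβ
      obtain ⟨hne, hβ⟩ := Finset.mem_erase.1 hβ
      rcases lt_or_gt_of_ne hne with h | h
      · left
        linarith [hD.entries_separated hsign hZ hz hβ hα h, (hk i).1]
      · right
        linarith [hD.entries_separated hsign hZ hz hα hβ h, (hk i).2]
  · have hfilter : (Finset.univ.filter fun j : D.gens k => a j = v) = ∅ :=
      Finset.filter_eq_empty_iff.2 fun j _ hj => hex ⟨j, hj⟩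
    rw [hfilter, Finset.sum_empty, Finset.card_empty, hcount]
    · exact ⟨_, (add_zero _).symm, Finset.card_filter_le _ _⟩
    · intro α hα
      by_contra! h
      have := hD.add_smul_mem_zone hZ hz hα (t := 0) ⟨h.2, h.1⟩
      rw [zero_smul, add_zero] at this
      obtain ⟨i, hi, _⟩ := hD.exists_gen_of_mem_zone hsign this hk
      exact hex ⟨i, hi⟩

end IsTilingOf

end BoxFamily

end Corner

/-! ### The lift of a zonotope to the cube given by a tiling -/

section CornerPosition

/-- A nonempty bounded set can only be contained in a translate of itself if the translation is
trivial. -/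
theorem eq_zero_of_forall_sub_mem {E : Type*} [NormedAddCommGroup E] [NormedSpace ℝ E] {Z : Set E}
    (hZ : Bornology.IsBounded Z) {z w : E} (hz : z ∈ Z) (h : ∀ z ∈ Z, z - w ∈ Z) : w = 0 := by
  have hiter : ∀ n : ℕ, z - (n : ℝ) • w ∈ Z := by
    intro n
    induction n with
    | zero => simpa using hz
    | succ n ih =>
      have := h _ ih
      convert this using 1
      push_cast
      module
  obtain ⟨r, hr⟩ := hZ.exists_norm_le
  by_contra hw
  obtain ⟨n, hn⟩ := exists_nat_gt ((r + ‖z‖) / ‖w‖)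
  rw [div_lt_iff₀ (norm_pos_iff.2 hw)] at hn
  have h1 := hr _ (hiter n)
  have h2 := norm_sub_norm_le ((n : ℝ) • w) z
  rw [norm_sub_rev, norm_smul, Real.norm_natCast] at h2
  linarith

theorem sum_eq_sum_fiber {E ι M κ : Type*} [AddCommGroup E] [DecidableEq E] [Fintype ι]
    [AddCommMonoid M] [Fintype κ] {a : ι → E} (f : κ → ι) (hf : ∀ j, a (f j) ≠ 0) (g : κ → M) :
    ∑ j, g j = ∑ q ∈ (Finset.univ.image a).erase 0, ∑ j with a (f j) = q, g j := by
  refine (Finset.sum_fiberwise_of_maps_to (fun j _ => ?_) g).symm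
  exact Finset.mem_erase.2 ⟨hf j, Finset.mem_image_of_mem a (Finset.mem_univ _)⟩

variable {E : Type*} [NormedAddCommGroup E] [NormedSpace ℝ E] [FiniteDimensional ℝ E]
  {ι : Type*} [Fintype ι]

namespace BoxFamily.IsTilingOf

variable {a : ι → E} {K : Type*} {D : BoxFamily a K} {Z : Set E} (hD : D.IsTilingOf Z)
  (hsign : ∀ i j, a i = -a j → a i = 0)
include hD hsign

/-- The height functions are the coordinates of a lift of the zonotope to the cube: the combination
of the generators with the heights as coefficients recovers the points of the zonotope.  The
difference of both is continuous and has only finitely many values; it is the base point, because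
otherwise the zonotope would contain a translate of itself. -/
theorem eq_add_sum_zoneLength [Fintype K] [DecidableEq E] {b : E}
    (hZ : Z = translatedZonotope a b) {z : E} (hz : z ∈ interior Z) :
    z = b + ∑ q ∈ (Finset.univ.image a).erase 0, D.zoneLength Z q (Set.Iio 0) z • q := by
  classical
  have hconv : Convex ℝ Z := hZ ▸ convex_translatedZonotope a b
  have hcomp : IsCompact Z := hZ ▸ isCompact_translatedZonotope a b
  set Q := (Finset.univ.image a).erase 0
  set F : E → E → ℝ := fun q z => D.zoneLength Z q (Set.Iio 0) z
  have hF : ∀ z ∈ interior Z, ∀ k, z ∈ D.cell k → ∀ q ∈ Q, ∃ m : ℕ,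
      F q z = m + ∑ i ∈ Finset.univ.filter fun i : D.gens k => a i = q, D.coord k i z ∧
        m ≤ (Finset.univ.filter fun i => a i = q).card := by
    intro z hz k hk q hq
    obtain ⟨m, h1, h2⟩ := hD.exists_zoneLength_eq hsign hconv (v := q) hz hk
    have h3 := hD.card_entries_le hsign hZ (Finset.ne_of_mem_erase hq) hz
    exact ⟨m, h1, by omega⟩
  -- the values of the difference are determined by a cell and finitely many bounded integers
  have hfin : ((fun z => z - ∑ q ∈ Q, F q z • q) '' interior Z).Finite := by
    refine (Set.finite_range fun p : K × (Q → Fin (Fintype.card ι + 1)) =>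
      D.corner p.1 - ∑ q : Q, ((p.2 q : ℕ) : ℝ) • (q : E)).subset ?_
    rintro _ ⟨z, hz, rfl⟩
    obtain ⟨k, hk⟩ := Set.mem_iUnion.1 (hD.iUnion_cell.symm ▸ interior_subset hz)
    choose! m hm hm' using hF z hz k hk
    refine ⟨(k, fun q => ⟨m q, Nat.lt_succ_of_le
      ((hm' q q.2).trans (Finset.card_le_univ _))⟩), ?_⟩
    simp only
    rw [Finset.sum_coe_sort Q fun q => (m q : ℝ) • q]
    have h1 := D.eq_corner_add_sum k z
    rw [sum_eq_sum_fiber (fun i : D.gens k => (i : ι)) (D.gen_ne_zero k)] at h1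
    have h2 : ∑ q ∈ Q, F q z • q = ∑ q ∈ Q, (m q : ℝ) • q +
        ∑ q ∈ Q, ∑ i ∈ Finset.univ.filter fun i : D.gens k => a i = q, D.coord k i z • a i := by
      rw [← Finset.sum_add_distrib]
      refine Finset.sum_congr rfl fun q hq => ?_
      rw [hm q hq, add_smul, Finset.sum_smul]
      congr 1
      exact Finset.sum_congr rfl fun i hi => by rw [(Finset.mem_filter.1 hi).2]
    rw [h2, ← sub_eq_iff_eq_add.2 h1]
    abel
  have hcont : ContinuousOn (fun z => z - ∑ q ∈ Q, F q z • q) (interior Z) := by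
    refine continuousOn_id.sub (continuousOn_finsetSum _ fun q hq => ?_)
    refine ContinuousOn.smul (fun z hz => ?_) continuousOn_const
    exact (hD.continuousAt_zoneLength hsign hconv hcomp (Finset.ne_of_mem_erase hq) hz
      measurableSet_Iio).continuousWithinAt
  set z₀ := z - ∑ q ∈ Q, F q z • q with hz₀
  have hconst : ∀ w ∈ interior Z, w = z₀ + ∑ q ∈ Q, F q w • q := by
    intro w hw
    exact sub_eq_iff_eq_add.1
      (hconv.interior.isPreconnected.eq_of_finite_image hcont hfin hw hz)
  suffices h : z₀ - b = 0 by
    rw [← sub_eq_zero.1 h]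
    exact hconst z hz
  have hsub : ∀ w ∈ Z, w - (z₀ - b) ∈ Z := by
    have hcl : IsClosed ((fun w => w - (z₀ - b)) ⁻¹' Z) :=
      hcomp.isClosed.preimage (by fun_prop)
    have hclos : closure (interior Z) = Z := by
      rw [hconv.closure_interior_eq_closure_of_nonempty_interior ⟨z, hz⟩,
        hcomp.isClosed.closure_eq]
    intro w hw
    rw [← hclos] at hw
    refine closure_minimal (fun w hw => ?_) hcl hw
    obtain ⟨k, hk⟩ := Set.mem_iUnion.1 (hD.iUnion_cell.symm ▸ interior_subset hw)
    have hbd : ∀ q ∈ Q, 0 ≤ F q w ∧ F q w ≤ (Finset.univ.filter fun i => a i = q).card := by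
      intro q hq
      refine ⟨measureReal_nonneg, ?_⟩
      obtain ⟨m, h1, h2⟩ := hD.exists_zoneLength_eq hsign hconv (v := q) hw hk
      have h3 := hD.card_entries_le hsign hZ (Finset.ne_of_mem_erase hq) hw
      have h4 : ∑ i ∈ Finset.univ.filter fun i : D.gens k => a i = q, D.coord k i w ≤
          (Finset.univ.filter fun i : D.gens k => a i = q).card := by
        rw [← nsmul_one, ← Finset.sum_const]
        exact Finset.sum_le_sum fun i _ => (hk i).2
      have h5 : (m : ℝ) + (Finset.univ.filter fun i : D.gens k => a i = q).card ≤
          (Finset.univ.filter fun i => a i = q).card := by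
        exact_mod_cast h2.trans h3
      change D.zoneLength Z q (Set.Iio 0) w ≤ _
      linarith
    -- distribute the height of `q` evenly among the generators equal to `q`
    rw [hZ]
    refine ⟨fun i => if a i = 0 then 0 else
      F (a i) w / (Finset.univ.filter fun j => a j = a i).card, fun i => ?_, ?_⟩
    · by_cases hi : a i = 0
      · simp [hi]
      · have h := hbd (a i) (Finset.mem_erase.2
          ⟨hi, Finset.mem_image_of_mem a (Finset.mem_univ i)⟩)
        simp only [if_neg hi]
        exact ⟨div_nonneg h.1 (Nat.cast_nonneg _), div_le_one_of_le₀ h.2 (Nat.cast_nonneg _)⟩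
    · have hsum : ∑ i, (if a i = 0 then 0 else
          F (a i) w / (Finset.univ.filter fun j => a j = a i).card) • a i =
          ∑ q ∈ Q, F q w • q := by
        rw [← Finset.sum_fiberwise_of_maps_to (g := a) (t := Finset.univ.image a)
          fun i _ => Finset.mem_image_of_mem a (Finset.mem_univ i)]
        refine (Finset.sum_erase (Finset.univ.image a) (a := 0) ?_).symm.trans ?_
        swap
        · refine Finset.sum_congr rfl fun q hq => ?_
          obtain ⟨hq0, hq⟩ := Finset.mem_erase.1 hq
          have hcard : ((Finset.univ.filter fun i => a i = q).card : ℝ) ≠ 0 := by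
            obtain ⟨i, _, hi⟩ := Finset.mem_image.1 hq
            have : 0 < (Finset.univ.filter fun i => a i = q).card :=
              Finset.card_pos.2 ⟨i, by simp [hi]⟩
            exact_mod_cast this.ne'
          rw [Finset.sum_congr rfl fun i hi => by
            rw [(Finset.mem_filter.1 hi).2, if_neg hq0], Finset.sum_const,
            ← Nat.cast_smul_eq_nsmul ℝ, smul_smul, mul_div_cancel₀ _ hcard]
        · exact Finset.sum_eq_zero fun i hi => by rw [(Finset.mem_filter.1 hi).2, smul_zero]
      rw [hsum, ← sub_eq_iff_eq_add'.2 (hconst w hw)]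
      module
  exact eq_zero_of_forall_sub_mem hcomp.isBounded (interior_subset hz) hsub

/-- The corner of each tile is the base point plus a subset sum of the generators that the tile
does not use. -/
theorem exists_corner_eq [Fintype K] {b : E} (hZ : Z = translatedZonotope a b) (k : K) :
    ∃ U : Finset ι, Disjoint U (D.gens k) ∧ D.corner k = b + ∑ i ∈ U, a i := by
  classical
  have hconv : Convex ℝ Z := hZ ▸ convex_translatedZonotope a b
  set Q := (Finset.univ.image a).erase 0
  obtain ⟨z, hzk, -⟩ := D.exists_coord_eq_half k
  have hz : z ∈ interior Z := interior_mono (hD.cell_subset k) hzk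
  have hk := interior_subset hzk
  have hm : ∀ q ∈ Q, ∃ m : ℕ, D.zoneLength Z q (Set.Iio 0) z =
      m + ∑ i ∈ Finset.univ.filter fun i : D.gens k => a i = q, D.coord k i z ∧
      m ≤ (Finset.univ.filter fun i => a i = q ∧ i ∉ D.gens k).card := by
    intro q hq
    obtain ⟨m, h1, h2⟩ := hD.exists_zoneLength_eq hsign hconv (v := q) hz hk
    have h3 := hD.card_entries_le hsign hZ (Finset.ne_of_mem_erase hq) hz
    refine ⟨m, h1, ?_⟩
    have h4 : (Finset.univ.filter fun i : D.gens k => a i = q).card =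
        (Finset.univ.filter fun i => a i = q ∧ i ∈ D.gens k).card := by
      refine Finset.card_bij (fun i _ => i) (fun i hi => ?_) (fun i _ j _ h => Subtype.ext h)
        fun i hi => ?_
      · have := (Finset.mem_filter.1 hi).2
        simpa using this
      · obtain ⟨h5, h6⟩ := (Finset.mem_filter.1 hi).2
        exact ⟨⟨i, h6⟩, by simpa using h5, rfl⟩
    have h5 := Finset.card_filter_add_card_filter_not
      (s := Finset.univ.filter fun i => a i = q) (fun i => i ∈ D.gens k)
    rw [Finset.filter_filter, Finset.filter_filter] at h5
    omega
  choose! m hm1 hm2 using hm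
  choose! V hV1 hV2 using fun q (hq : q ∈ Q) => Finset.exists_subset_card_eq (hm2 q hq)
  have hVa : ∀ q ∈ Q, ∀ i ∈ V q, a i = q ∧ i ∉ D.gens k := fun q hq i hi =>
    (Finset.mem_filter.1 (hV1 q hq hi)).2
  refine ⟨Q.biUnion V, ?_, ?_⟩
  · refine Finset.disjoint_left.2 fun i hi => ?_
    obtain ⟨q, hq, hi⟩ := Finset.mem_biUnion.1 hi
    exact (hVa q hq i hi).2
  · have hdisj : (Q : Set E).PairwiseDisjoint V := by
      intro q hq q' hq' hne
      refine Finset.disjoint_left.2 fun i hi hi' => hne ?_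
      rw [← (hVa q hq i hi).1, (hVa q' hq' i hi').1]
    rw [Finset.sum_biUnion hdisj]
    have h1 : ∑ q ∈ Q, ∑ i ∈ V q, a i = ∑ q ∈ Q, (m q : ℝ) • q := by
      refine Finset.sum_congr rfl fun q hq => ?_
      rw [Finset.sum_congr rfl fun i hi => (hVa q hq i hi).1, Finset.sum_const, hV2 q hq,
        Nat.cast_smul_eq_nsmul]
    have h2 := D.eq_corner_add_sum k z
    rw [sum_eq_sum_fiber (fun i : D.gens k => (i : ι)) (D.gen_ne_zero k)] at h2
    have h3 : ∑ q ∈ Q, D.zoneLength Z q (Set.Iio 0) z • q = ∑ q ∈ Q, (m q : ℝ) • q +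
        ∑ q ∈ Q, ∑ i ∈ Finset.univ.filter fun i : D.gens k => a i = q, D.coord k i z • a i := by
      rw [← Finset.sum_add_distrib]
      refine Finset.sum_congr rfl fun q hq => ?_
      rw [hm1 q hq, add_smul, Finset.sum_smul]
      congr 1
      exact Finset.sum_congr rfl fun i hi => by rw [(Finset.mem_filter.1 hi).2]
    have h4 := hD.eq_add_sum_zoneLength hsign hZ hz
    rw [h3] at h4
    rw [h1]
    have h5 := h2.symm.trans h4
    rw [← add_assoc] at h5
    exact add_right_cancel h5

end BoxFamily.IsTilingOf

end CornerPosition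

/-! ### Images of faces of the cube -/

section FaceImage

variable {E : Type*} [AddCommGroup E] [Module ℝ E] {ι : Type*} [Fintype ι]

/-- The image of the face `x = 0` on `L`, `x = 1` on `U` of the unit cube under the affine map
`x ↦ b + ∑ x i • a i`. -/
def faceImage (a : ι → E) (b : E) (L U : Set ι) : Set E :=
  {z | ∃ x : ι → ℝ, (∀ i, 0 ≤ x i ∧ x i ≤ 1) ∧ (∀ i ∈ L, x i = 0) ∧ (∀ i ∈ U, x i = 1) ∧
    z = b + ∑ i, x i • a i}

theorem faceImage_subset_flip [DecidableEq ι] (a : ι → E) (b : E) (L U : Set ι) (N : Finset ι) :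
    faceImage a b L U ⊆ faceImage (fun i => if i ∈ N then -a i else a i) (b + ∑ i ∈ N, a i)
      (L \ N ∪ U ∩ N) (U \ N ∪ L ∩ N) := by
  rintro z ⟨x, h1, h2, h3, rfl⟩
  refine ⟨fun i => if i ∈ N then 1 - x i else x i, fun i => ?_, fun i hi => ?_, fun i hi => ?_, ?_⟩
  · have := h1 i
    dsimp only
    split_ifs
    · constructor <;> linarith
    · exact this
  · rcases hi with ⟨hi, hN⟩ | ⟨hi, hN⟩
    · have hN' : i ∉ N := hN
      simp [hN', h2 i hi]
    · have hN' : i ∈ N := hN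
      simp [hN', h3 i hi]
  · rcases hi with ⟨hi, hN⟩ | ⟨hi, hN⟩
    · have hN' : i ∉ N := hN
      simp [hN', h3 i hi]
    · have hN' : i ∈ N := hN
      simp [hN', h2 i hi]
  · have hsum : ∑ i ∈ N, a i = ∑ i, if i ∈ N then a i else 0 := by
      rw [← Finset.sum_filter, Finset.filter_mem_eq_inter, Finset.univ_inter]
    rw [hsum, add_assoc, ← Finset.sum_add_distrib]
    congr 1
    refine Finset.sum_congr rfl fun i _ => ?_
    by_cases hi : i ∈ N
    · simp only [if_pos hi]
      module
    · simp only [if_neg hi, zero_add]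

/-- Replacing some generators by their negatives exchanges the two bounds at these generators. -/
theorem faceImage_flip [DecidableEq ι] (a : ι → E) (b : E) (L U : Set ι) (N : Finset ι) :
    faceImage a b L U = faceImage (fun i => if i ∈ N then -a i else a i) (b + ∑ i ∈ N, a i)
      (L \ N ∪ U ∩ N) (U \ N ∪ L ∩ N) := by
  refine (faceImage_subset_flip a b L U N).antisymm ?_
  refine (faceImage_subset_flip _ _ _ _ N).trans_eq ?_
  congr 1
  · ext i
    split_ifs <;> simp
  · rw [add_assoc, ← Finset.sum_add_distrib, Finset.sum_eq_zero, add_zero]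
    intro i hi
    simp [hi]
  · ext i
    by_cases hi : i ∈ N <;> simp [hi]
  · ext i
    by_cases hi : i ∈ N <;> simp [hi]

theorem faceImage_eq_of_disjoint [DecidableEq ι] (a : ι → E) (b : E) (L : Set ι) (U : Finset ι)
    (hLU : Disjoint L (U : Set ι)) :
    faceImage a b L U = faceImage a (b + ∑ i ∈ U, a i) (L ∪ U) ∅ := by
  have hsum : ∑ i ∈ U, a i = ∑ i, if i ∈ U then a i else 0 := by
    rw [← Finset.sum_filter, Finset.filter_mem_eq_inter, Finset.univ_inter]
  apply Set.Subset.antisymm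
  · rintro z ⟨x, h1, h2, h3, rfl⟩
    refine ⟨fun i => if i ∈ U then 0 else x i, fun i => ?_, fun i hi => ?_, by simp, ?_⟩
    · dsimp only
      split_ifs
      · norm_num
      · exact h1 i
    · rcases hi with hi | hi
      · simp [h2 i hi]
      · simp [Finset.mem_coe.1 hi]
    · rw [hsum, add_assoc, ← Finset.sum_add_distrib]
      congr 1
      refine Finset.sum_congr rfl fun i _ => ?_
      by_cases hi : i ∈ U
      · simp only [if_pos hi]
        rw [h3 i hi, one_smul, zero_smul, add_zero]
      · simp only [if_neg hi, zero_add]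
  · rintro z ⟨x, h1, h2, -, rfl⟩
    refine ⟨fun i => if i ∈ U then 1 else x i, fun i => ?_, fun i hi => ?_, fun i hi => ?_, ?_⟩
    · dsimp only
      split_ifs
      · norm_num
      · exact h1 i
    · have : i ∉ U := fun h => Set.disjoint_left.1 hLU hi h
      simp [this, h2 i (Or.inl hi)]
    · simp [Finset.mem_coe.1 hi]
    · rw [hsum, add_assoc, ← Finset.sum_add_distrib]
      congr 1
      refine Finset.sum_congr rfl fun i _ => ?_
      by_cases hi : i ∈ U
      · simp only [if_pos hi]
        rw [h2 i (Or.inr hi), one_smul, zero_smul, add_zero]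
      · simp only [if_neg hi, zero_add]

theorem faceImage_empty (a : ι → E) (b : E) :
    faceImage a b ∅ ∅ = {z | ∃ x : ι → ℝ, (∀ i, 0 ≤ x i ∧ x i ≤ 1) ∧ z = b + ∑ i, x i • a i} := by
  simp [faceImage]

end FaceImage

theorem BoxFamily.cell_eq_faceImage {E : Type*} [NormedAddCommGroup E] [NormedSpace ℝ E]
    [FiniteDimensional ℝ E] {ι : Type*} [Fintype ι] {a : ι → E} {K : Type*} (D : BoxFamily a K)
    (k : K) : D.cell k = faceImage a (D.corner k) {i | i ∉ D.gens k} ∅ := by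
  classical
  have hsum : ∀ x : ι → ℝ, (∀ i, i ∉ D.gens k → x i = 0) →
      ∑ i, x i • a i = ∑ i : D.gens k, x i • a i := by
    intro x hx
    rw [Finset.sum_coe_sort (D.gens k) fun i => x i • a i]
    exact (Finset.sum_subset (Finset.subset_univ _) fun i _ hi => by
      rw [hx i hi, zero_smul]).symm
  apply Set.Subset.antisymm
  · intro z hz
    refine ⟨fun i => if hi : i ∈ D.gens k then D.coord k ⟨i, hi⟩ z else 0, fun i => ?_,
      fun i hi => dif_neg hi, by simp, ?_⟩
    · dsimp only
      split_ifs with hi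
      · exact hz ⟨i, hi⟩
      · norm_num
    · rw [hsum _ fun i hi => dif_neg hi]
      simpa using D.eq_corner_add_sum k z
  · rintro z ⟨x, h1, h2, -, rfl⟩ i
    have : D.coord k i (D.corner k + ∑ i, x i • a i) = x i := by
      rw [coord, add_sub_cancel_left, hsum x h2]
      simp only [← D.basis_apply]
      rw [Basis.repr_sum_self]
    rw [this]
    exact h1 i

section FineTiling

variable {κ ι : Type*} [Fintype ι]

theorem zonotope_eq_faceImage (A : Matrix κ ι ℝ) (b : κ → ℝ) :
    zonotope A b = faceImage A.col b ∅ ∅ := by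
  rw [faceImage_empty]
  ext z
  simp only [zonotope, Set.mem_ofPred_eq]
  refine exists_congr fun x => and_congr_right fun _ => ?_
  rw [add_comm, Matrix.mulVec_eq_sum]
  simp [Matrix.col]

theorem zonotope_deleteCols_eq_faceImage (A : Matrix κ ι ℝ) (S : Set ι)
    [Fintype {i // i ∉ S}] (b : κ → ℝ) :
    zonotope (deleteCols A S) b = faceImage A.col b S ∅ := by
  classical
  rw [zonotope_eq_faceImage, faceImage_empty]
  have hsum : ∀ x : ι → ℝ, (∀ i ∈ S, x i = 0) →
      ∑ i, x i • A.col i = ∑ i : {i // i ∉ S}, x i • (deleteCols A S).col i := by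
    intro x hx
    rw [← Finset.sum_subset (Finset.subset_univ (Finset.univ.filter fun i => i ∉ S))]
    · refine Finset.sum_subtype _ (fun i => by simp) _
    · intro i _ hi
      rw [hx i (by simpa using hi), zero_smul]
  ext z
  constructor
  · rintro ⟨x, hx, rfl⟩
    refine ⟨fun i => if hi : i ∈ S then 0 else x ⟨i, hi⟩, fun i => ?_, fun i hi => dif_pos hi,
      by simp, ?_⟩
    · dsimp only
      split_ifs with hi
      · norm_num
      · exact hx _
    · rw [hsum _ fun i hi => dif_pos hi]
      congr 1
      exact Finset.sum_congr rfl fun i _ => by rw [dif_neg i.2]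
  · rintro ⟨x, h1, h2, -, rfl⟩
    exact ⟨fun i => x i, fun i => h1 i, by rw [hsum x h2]⟩

/-- An extreme subset of a zonotope that contains its centre is the whole zonotope: the centre is
the midpoint of each point and its reflection. -/
theorem faceImage_subset_of_center_mem {E : Type*} [AddCommGroup E] [Module ℝ E] {a : ι → E}
    {c : E} {S : Set ι} {X : Set E} (hX : IsExtreme ℝ (faceImage a c S ∅) X) [DecidablePred (· ∈ S)]
    (h : c + ∑ i, (if i ∈ S then (0 : ℝ) else 1 / 2) • a i ∈ X) : faceImage a c S ∅ ⊆ X := by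
  rintro z ⟨x, h1, h2, -, rfl⟩
  refine hX.left_mem_of_mem_openSegment (y := c + ∑ i, (if i ∈ S then 0 else 1 - x i) • a i)
    ⟨x, h1, h2, by simp, rfl⟩ ⟨_, fun i => ?_, fun i hi => if_pos hi, by simp, rfl⟩ h
    ⟨1 / 2, 1 / 2, by norm_num, by norm_num, by norm_num, ?_⟩
  · have := h1 i
    split_ifs
    · norm_num
    · constructor <;> linarith
  · rw [smul_add, smul_add, add_add_add_comm, ← add_smul, Finset.smul_sum, Finset.smul_sum,
      ← Finset.sum_add_distrib]
    congr 1
    · norm_num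
    · refine Finset.sum_congr rfl fun i _ => ?_
      split_ifs with hi
      · rw [h2 i hi]
        simp
      · module

theorem interior_faceImage_nonempty [Fintype κ] {a : ι → κ → ℝ} (b : κ → ℝ)
    (hspan : ∀ z : κ → ℝ, ∃ x : ι → ℝ, ∑ i, x i • a i = z) :
    (interior (faceImage a b ∅ ∅)).Nonempty := by
  set f : (ι → ℝ) →ₗ[ℝ] (κ → ℝ) := Fintype.linearCombination ℝ a
  have hf : Function.Surjective f := fun z => by
    obtain ⟨x, hx⟩ := hspan z
    exact ⟨x, by simpa [f, Fintype.linearCombination_apply] using hx⟩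
  have hopen : IsOpen (Set.pi Set.univ fun _ : ι => Set.Ioo (0 : ℝ) 1) :=
    isOpen_set_pi Set.finite_univ fun _ _ => isOpen_Ioo
  have hopen' := (Homeomorph.addLeft b).isOpenMap _
    (f.isOpenMap_of_finiteDimensional hf _ hopen)
  refine ⟨b + f fun _ => 1 / 2, mem_interior.2 ⟨_, ?_, hopen', ?_⟩⟩
  · rintro _ ⟨_, ⟨x, hx, rfl⟩, rfl⟩
    rw [faceImage_empty]
    refine ⟨x, fun i => ⟨(hx i trivial).1.le, (hx i trivial).2.le⟩, ?_⟩
    simp [f, Fintype.linearCombination_apply]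
  · refine ⟨_, ⟨fun _ => 1 / 2, fun i _ => ?_, rfl⟩, rfl⟩
    norm_num

end FineTiling

/-! ### Tiles of fine zonotopal tilings -/

section FineTiling

variable {κ ι : Type*} {P : Set (κ → ℝ)} {𝒞 : Set (Set (κ → ℝ))}

theorem IsPolyhedralSubdivision.isClosed (h : IsPolyhedralSubdivision P 𝒞) {C : Set (κ → ℝ)}
    (hC : C ∈ 𝒞) : IsClosed C := by
  obtain ⟨s, rfl⟩ := h.polytope C hC
  exact (s.finite_toSet.isCompact_convexHull ℝ).isClosed

theorem IsPolyhedralSubdivision.exists_tile_mem (h : IsPolyhedralSubdivision P 𝒞) {z : κ → ℝ}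
    (hz : z ∈ P) : ∃ C, IsTile 𝒞 C ∧ z ∈ C := by
  rw [← h.sUnion_eq] at hz
  obtain ⟨D, hD, hzD⟩ := hz
  obtain ⟨C, hDC, hC⟩ := h.finite.exists_le_maximal hD
  exact ⟨C, hC, hDC hzD⟩

variable [Fintype κ] [Fintype ι] {A : Matrix κ ι ℝ} {b : κ → ℝ}

/-- Tiles of a subdivision of a convex body with interior points that are zonotopes on linearly
independent generators are full-dimensional: the full-dimensional tiles cover everything, because
the others have measure zero, and a tile whose centre lies in another cell is a face of it. -/
theorem IsPolyhedralSubdivision.card_gens_eq (h : IsPolyhedralSubdivision P 𝒞)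
    (hconv : Convex ℝ P) (hint : (interior P).Nonempty) {a : ι → κ → ℝ}
    (σ : Set (κ → ℝ) → Set ι) (c : Set (κ → ℝ) → κ → ℝ)
    (hσ : ∀ C, IsTile 𝒞 C → C = faceImage a (c C) (σ C) ∅)
    (hind : ∀ C, IsTile 𝒞 C → LinearIndependent ℝ fun i : {i // i ∉ σ C} => a i)
    {C : Set (κ → ℝ)} (hC : IsTile 𝒞 C) :
    Nat.card {i // i ∉ σ C} = finrank ℝ (κ → ℝ) := by
  classical
  set d := finrank ℝ (κ → ℝ)
  by_contra hne
  set full : Set (Set (κ → ℝ)) := {D | IsTile 𝒞 D ∧ Nat.card {i // i ∉ σ D} = d}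
  set low : Set (Set (κ → ℝ)) := {D | IsTile 𝒞 D ∧ Nat.card {i // i ∉ σ D} ≠ d}
  have hfull : full.Finite := h.finite.subset fun D hD => hD.1.prop
  have hlow : low.Finite := h.finite.subset fun D hD => hD.1.prop
  set m := c C + ∑ i, (if i ∈ σ C then (0 : ℝ) else 1 / 2) • a i with hm
  have hmC : m ∈ C := by
    rw [hσ C hC]
    refine ⟨_, fun i => ?_, fun i hi => if_pos hi, by simp, rfl⟩
    split_ifs <;> norm_num
  have hmfull : m ∉ ⋃ D ∈ full, D := by
    intro hmem
    obtain ⟨D, hD, hmD⟩ := Set.mem_iUnion₂.1 hmem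
    have hext : IsExtreme ℝ C (C ∩ D) := (h.inter_face C hC.prop D hD.1.prop).isExtreme
    have hsub : C ⊆ C ∩ D := by
      have hext' : IsExtreme ℝ (faceImage a (c C) (σ C) ∅) (C ∩ D) := by
        rw [← hσ C hC]
        exact hext
      exact (hσ C hC).subset.trans (faceImage_subset_of_center_mem hext' ⟨hmC, hmD⟩)
    have hCD : C = D := hC.eq_of_le hD.1.prop fun z hz => (hsub hz).2
    exact hne (hCD ▸ hD.2)
  have hclosed : IsClosed (⋃ D ∈ full, D) :=
    hfull.isClosed_biUnion fun D hD => h.isClosed hD.1.prop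
  have hmP : m ∈ closure (interior P) := by
    rw [hconv.closure_interior_eq_closure_of_nonempty_interior hint]
    refine subset_closure ?_
    rw [← h.sUnion_eq]
    exact ⟨C, hC.prop, hmC⟩
  have hO : ((⋃ D ∈ full, D)ᶜ ∩ interior P).Nonempty :=
    mem_closure_iff.1 hmP _ hclosed.isOpen_compl hmfull
  have hpos := (hclosed.isOpen_compl.inter isOpen_interior).measure_pos volume hO
  refine hpos.ne' (measure_mono_null (t := ⋃ D ∈ low, D) ?_ ?_)
  · rintro z ⟨hz, hzP⟩
    obtain ⟨D, hD, hzD⟩ := h.exists_tile_mem (interior_subset hzP)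
    refine Set.mem_iUnion₂.2 ⟨D, ⟨hD, fun hcard => hz ?_⟩, hzD⟩
    exact Set.mem_iUnion₂.2 ⟨D, ⟨hD, hcard⟩, hzD⟩
  · refine (measure_biUnion_null_iff hlow.countable).2 fun D hD => ?_
    set s := Submodule.span ℝ (Set.range fun i : {i // i ∉ σ D} => a i)
    have hs : s ≠ ⊤ := by
      intro htop
      have h1 := finrank_span_eq_card (hind D hD.1)
      rw [show Submodule.span ℝ (Set.range fun i : {i // i ∉ σ D} => a i) = ⊤ from htop,
        finrank_top, ← Nat.card_eq_fintype_card] at h1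
      exact hD.2 h1.symm
    refine measure_mono_null (t := (fun z => z + -c D) ⁻¹' (s : Set (κ → ℝ))) ?_ ?_
    · intro z hz
      rw [hσ D hD.1] at hz
      obtain ⟨x, -, hx, -, rfl⟩ := hz
      change c D + ∑ i, x i • a i + -c D ∈ s
      rw [add_neg_cancel_comm]
      refine s.sum_mem fun i _ => ?_
      by_cases hi : i ∈ σ D
      · rw [hx i hi, zero_smul]
        exact s.zero_mem
      · exact s.smul_mem _ (Submodule.subset_span ⟨⟨i, hi⟩, rfl⟩)
    · rw [measure_preimage_add_right]
      exact Measure.addHaar_submodule volume s hs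

/-- A choice of signs after which no two nonzero generators are negatives of each other: all nonzero
generators are put on the positive side of a hyperplane that contains none of them. -/
theorem exists_signs [DecidableEq ι] (a : ι → κ → ℝ) :
    ∃ N : Finset ι, ∀ i j, (if i ∈ N then -a i else a i) = -(if j ∈ N then -a j else a j) →
      (if i ∈ N then -a i else a i) = 0 := by
  classical
  obtain ⟨f, hf⟩ := Module.exists_dual_forall_apply_ne_zero (K := ℝ)
    (fun i : {i // a i ≠ 0} => a i) fun i => i.2
  set N : Finset ι := Finset.univ.filter fun i => f (a i) < 0
  have hnn : ∀ i, 0 ≤ f (if i ∈ N then -a i else a i) := by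
    intro i
    by_cases hi : f (a i) < 0
    · have : i ∈ N := by simp [N, hi]
      rw [if_pos this, map_neg]
      linarith
    · have : i ∉ N := by simpa [N] using hi
      rw [if_neg this]
      linarith
  refine ⟨N, fun i j hij => ?_⟩
  have h1 := congrArg f hij
  rw [map_neg] at h1
  have h2 : f (if i ∈ N then -a i else a i) = 0 := by linarith [hnn i, hnn j]
  by_contra hne
  have hai : a i ≠ 0 := by
    intro h0
    exact hne (by simp [h0])
  refine hf ⟨i, hai⟩ ?_
  by_cases hi : i ∈ N
  · simpa [hi] using h2
  · simpa [hi] using h2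

/-- Each tile of a fine zonotopal tiling of a zonotope is the image of a face of the unit cube whose
free coordinates form a basis. -/
theorem IsFineZonotopalTiling.exists_eq_faceImage
    (h : IsFineZonotopalTiling A P 𝒞) (hP : P = zonotope A b)
    (hspan : ∀ z : κ → ℝ, ∃ x : ι → ℝ, ∑ i, x i • A.col i = z)
    {C : Set (κ → ℝ)} (hC : IsTile 𝒞 C) :
    ∃ L U : Set ι, Disjoint L U ∧ C = faceImage A.col b L U ∧
      (∀ y : ι → ℝ, (∀ i ∈ L ∪ U, y i = 0) → ∑ i, y i • A.col i = 0 → y = 0) ∧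
      (∀ f : (κ → ℝ) →ₗ[ℝ] ℝ, (∀ i, i ∉ L ∪ U → f (A.col i) = 0) → f = 0) := by
  classical
  obtain ⟨σ, hσ, hσinj⟩ := h.fine
  choose! c hc using fun D (hD : IsTile 𝒞 D) => (hσ D hD).1
  have hface : ∀ D, IsTile 𝒞 D → D = faceImage A.col (c D) (σ D) ∅ := fun D hD =>
    (hc D hD).trans (zonotope_deleteCols_eq_faceImage A (σ D) (c D))
  rw [zonotope_eq_faceImage] at hP
  -- reduce to generators without pairs of opposite vectors
  obtain ⟨N, hN⟩ := exists_signs A.col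
  set a : ι → κ → ℝ := fun i => if i ∈ N then -A.col i else A.col i with ha
  set b' := b + ∑ i ∈ N, A.col i with hb'
  have hPa : P = translatedZonotope a b' := by
    rw [hP, faceImage_flip _ _ _ _ N, Set.empty_sdiff, Set.empty_inter, Set.empty_union,
      faceImage_empty]
    rfl
  have hind : ∀ D, IsTile 𝒞 D → LinearIndependent ℝ fun i : {i // i ∉ σ D} => A.col i :=
    fun D hD => (hσ D hD).2
  have hcard : ∀ D, IsTile 𝒞 D → Nat.card {i // i ∉ σ D} = finrank ℝ (κ → ℝ) := fun D hD =>
    h.card_gens_eq (hPa ▸ convex_translatedZonotope a b')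
      (hP ▸ interior_faceImage_nonempty b hspan) σ c hface hind hD
  let K := {D // IsTile 𝒞 D}
  have : Finite K := (h.finite.subset fun D (hD : IsTile 𝒞 D) => hD.prop).to_subtype
  have : Fintype K := Fintype.ofFinite K
  let gens : K → Finset ι := fun k => Finset.univ.filter fun i => i ∉ σ k.1
  have hgens : ∀ k i, i ∈ gens k ↔ i ∉ σ k.1 := fun k i => by simp [gens]
  let D : BoxFamily a K :=
    { gens := gens
      gens_mem := fun k => by
        refine mem_columnBases.2 ⟨?_, ?_⟩
        · have h1 := (hind k.1 k.2).comp (fun i : gens k => ⟨i, (hgens k i).1 i.2⟩)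
            fun i j hij => Subtype.ext (congrArg (fun q => q.1) hij)
          have h2 := h1.units_smul fun i : gens k => if (i : ι) ∈ N then -1 else 1
          have h3 : (fun i : gens k => a i) =
              (fun i : gens k => if (i : ι) ∈ N then (-1 : ℝˣ) else 1) •
                fun i : gens k => A.col i := by
            ext i j
            by_cases hi : (i : ι) ∈ N
            · simp [ha, hi]
            · simp [ha, hi]
          rw [h3]
          exact h2
        · rw [← hcard k.1 k.2, Nat.card_eq_fintype_card, Fintype.card_subtype]
      corner := fun k => c k.1 + ∑ i ∈ N, A.col i +
        ∑ i ∈ Finset.univ.filter fun i => i ∈ σ k.1 ∧ i ∈ N, a i }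
  have hcell : ∀ k, D.cell k = k.1 := by
    intro k
    rw [D.cell_eq_faceImage]
    conv_rhs => rw [hface k.1 k.2, faceImage_flip _ _ _ _ N]
    rw [Set.empty_inter, Set.empty_sdiff, Set.empty_union, Set.union_empty]
    have hU : σ k.1 ∩ N = ((Finset.univ.filter fun i => i ∈ σ k.1 ∧ i ∈ N : Finset ι) : Set ι) := by
      ext i; simp
    rw [hU, faceImage_eq_of_disjoint]
    · congr 1
      ext i
      by_cases hi : i ∈ N <;> simp [D, gens, hi]
    · rw [← hU]
      exact Set.disjoint_left.2 fun i hi hi' => hi.2 hi'.2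
  have hD : D.IsTilingOf P :=
    { gens_injective := by
        intro k k' hkk
        refine Subtype.ext (hσinj _ _ k.2 k'.2 (Set.ext fun i => ?_))
        have : i ∈ gens k ↔ i ∈ gens k' := by
          rw [show gens k = gens k' from hkk]
        rw [hgens, hgens] at this
        exact not_iff_not.1 this
      iUnion_cell := by
        ext z
        simp only [hcell, Set.mem_iUnion]
        constructor
        · rintro ⟨k, hk⟩
          rw [← h.sUnion_eq]
          exact ⟨k.1, k.2.prop, hk⟩
        · intro hz
          obtain ⟨C, hC, hzC⟩ := h.exists_tile_mem hz
          exact ⟨⟨C, hC⟩, hzC⟩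
      isExtreme := fun k k' => by
        rw [hcell, hcell]
        exact (h.inter_face _ k.2.prop _ k'.2.prop).isExtreme }
  set k : K := ⟨C, hC⟩
  obtain ⟨U, hUd, hU⟩ := hD.exists_corner_eq hN hPa k
  -- translate the corner back to the original signs
  set L₀ : Set ι := {i | i ∉ gens k} \ U
  have hUσ : ∀ i ∈ U, i ∈ σ C := by
    intro i hi
    by_contra hcon
    exact Finset.disjoint_left.1 hUd hi ((hgens k i).2 hcon)
  have hLU : L₀ ∪ U = σ C := by
    ext i
    by_cases hi : i ∈ U
    · simp [hi, hUσ i hi]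
    · simp [L₀, hi, hgens, k]
  have hLd : Disjoint L₀ (U : Set ι) := Set.disjoint_left.2 fun i hi hi' => hi.2 hi'
  have hCeq : C = faceImage A.col b (L₀ \ N ∪ U ∩ N) (U \ N ∪ L₀ ∩ N) := by
    have h1 : C = faceImage a (b' + ∑ i ∈ U, a i) (L₀ ∪ U) ∅ := by
      refine (hcell k).symm.trans ?_
      rw [← hU, hLU, D.cell_eq_faceImage]
      congr 1
      ext i
      exact not_congr (hgens k i) |>.trans not_not
    rw [← faceImage_eq_of_disjoint a b' L₀ U hLd] at h1
    rw [h1, faceImage_flip a b' L₀ U N]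
    congr 1
    · ext i
      by_cases hi : i ∈ N <;> simp [ha, hi]
    · rw [hb', add_assoc, ← Finset.sum_add_distrib, Finset.sum_eq_zero, add_zero]
      intro i hi
      simp [ha, hi]
  have hunion : (L₀ \ N ∪ U ∩ N) ∪ (U \ N ∪ L₀ ∩ N) = σ C := by
    rw [← hLU]
    ext i
    by_cases hi : i ∈ N <;> simp [hi, or_comm]
  refine ⟨_, _, ?_, hCeq, ?_, ?_⟩
  · refine Set.disjoint_left.2 fun i hi hi' => ?_
    rcases hi with hi | hi <;> rcases hi' with hi' | hi'
    · exact Set.disjoint_left.1 hLd hi.1 hi'.1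
    · exact hi.2 hi'.2
    · exact hi'.2 hi.2
    · exact Set.disjoint_left.1 hLd hi'.1 hi.1
  · rw [hunion]
    intro y hy hsum
    have h1 : ∑ i : {i // i ∉ σ C}, y i • A.col i = 0 := by
      rw [← hsum, ← Finset.sum_subset (Finset.subset_univ (Finset.univ.filter fun i => i ∉ σ C))]
      · exact (Finset.sum_subtype (Finset.univ.filter fun i => i ∉ σ C) (fun i => by simp)
          fun i => y i • A.col i).symm
      · intro i _ hi
        rw [hy i (by simpa using hi), zero_smul]
    have h2 := Fintype.linearIndependent_iff.1 (hind C hC) (fun i => y i) h1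
    ext i
    by_cases hi : i ∈ σ C
    · exact hy i hi
    · exact h2 ⟨i, hi⟩
  · rw [hunion]
    intro f hf
    have hli := hind C hC
    have htop : Submodule.span ℝ (Set.range fun i : {i // i ∉ σ C} => A.col i) = ⊤ :=
      hli.span_eq_top_of_card_eq_finrank' (by
        rw [← Nat.card_eq_fintype_card]
        exact hcard C hC)
    refine LinearMap.ext_on_range htop fun i => ?_
    rw [hf i i.2, LinearMap.zero_apply]

end FineTiling

namespace PESPInstance

open Digraph

variable {V : Type*} [Fintype V] {I : PESPInstance V} {𝓑 : Type*} {Γ : Matrix 𝓑 I.G.Arc ℤ}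

/-- Combining the generators amounts to applying `Γ / T` to a vector stretched by the spans. -/
theorem sum_smul_scaledCycleMatrix_col (y : I.G.Arc → ℝ) :
    ∑ a, y a • (I.scaledCycleMatrix Γ).col a =
      (1 / (I.T : ℝ)) • (Γ.map (Int.cast : ℤ → ℝ) *ᵥ fun a => (I.u a - I.l a) * y a) := by
  ext i
  simp only [Finset.sum_apply, Pi.smul_apply, smul_eq_mul, Matrix.col_apply, scaledCycleMatrix,
    Matrix.of_apply, Matrix.mulVec, dotProduct, Matrix.map_apply, Finset.mul_sum]
  exact Finset.sum_congr rfl fun a _ => by ring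

/-- The affine bijection from the unit cube to the box `l ≤ x ≤ u` maps faces to faces. -/
theorem faceImage_scaledCycleMatrix (hI : I.Standard) (L U : Set I.G.Arc) :
    faceImage (I.scaledCycleMatrix Γ).col (I.cycleOffsetMap Γ I.l) L U =
      I.cycleOffsetMap Γ '' I.boxFace L U := by
  have hw : ∀ a, 0 < I.u a - I.l a := fun a => sub_pos.2 (hI.l_lt_u a)
  have hmap : ∀ y : I.G.Arc → ℝ, I.cycleOffsetMap Γ I.l +
      ∑ a, y a • (I.scaledCycleMatrix Γ).col a =
      I.cycleOffsetMap Γ fun a => I.l a + (I.u a - I.l a) * y a := by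
    intro y
    rw [sum_smul_scaledCycleMatrix_col, cycleOffsetMap, cycleOffsetMap, ← smul_add,
      ← Matrix.mulVec_add]
    rfl
  apply Set.Subset.antisymm
  · rintro z ⟨y, h1, h2, h3, rfl⟩
    refine ⟨_, ⟨fun a => ?_, fun a ha => ?_, fun a ha => ?_⟩, (hmap y).symm⟩
    · have := h1 a
      have := hw a
      constructor <;> nlinarith
    · simp [h2 a ha]
    · simp [h3 a ha]
  · rintro _ ⟨x, ⟨h1, h2, h3⟩, rfl⟩
    refine ⟨fun a => (x a - I.l a) / (I.u a - I.l a), fun a => ⟨?_, ?_⟩, fun a ha => ?_,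
      fun a ha => ?_, ?_⟩
    · exact div_nonneg (by linarith [(h1 a).1]) (hw a).le
    · exact (div_le_one (hw a)).2 (by linarith [(h1 a).2])
    · simp [h2 a ha]
    · simp only [h3 a ha]
      exact div_self (hw a).ne'
    · rw [hmap]
      congr 1
      ext a
      rw [mul_div_cancel₀ _ (hw a).ne']
      ring

variable [DecidableEq V] [Fintype 𝓑]

theorem scaledCycleMatrix_col_surjective (hI : I.Standard) (hΓ : I.G.IsIntegralCycleMatrix Γ)
    (z : 𝓑 → ℝ) : ∃ x : I.G.Arc → ℝ, ∑ a, x a • (I.scaledCycleMatrix Γ).col a = z := by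
  classical
  have hT : (I.T : ℝ) ≠ 0 := by exact_mod_cast hI.T_pos.ne'
  choose p hp using fun i : 𝓑 =>
    hΓ.exists_mulVec_eq hI.loopless hI.not_antiparallel hI.connected (Pi.single i 1)
  refine ⟨fun a => (I.u a - I.l a)⁻¹ * (I.T * ∑ i, z i * p i a), ?_⟩
  rw [sum_smul_scaledCycleMatrix_col]
  have h1 : (fun a => (I.u a - I.l a) * ((I.u a - I.l a)⁻¹ * (I.T * ∑ i, z i * p i a))) =
      (I.T : ℝ) • ∑ i, z i • fun a => (p i a : ℝ) := by
    ext a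
    rw [mul_inv_cancel_left₀ (sub_pos.2 (hI.l_lt_u a)).ne']
    simp
  rw [h1, Matrix.mulVec_smul, smul_smul, one_div_mul_cancel hT, one_smul, Matrix.mulVec_sum]
  ext j
  have h2 : ∀ i, (Γ.map (Int.cast : ℤ → ℝ) *ᵥ fun a => (p i a : ℝ)) j =
      ((Pi.single i 1 : 𝓑 → ℤ) j : ℝ) := by
    intro i
    rw [← hp i]
    simp [Matrix.mulVec, dotProduct]
  simp only [Finset.sum_apply, Matrix.mulVec_smul, Pi.smul_apply, h2, smul_eq_mul]
  simp [Pi.single_apply]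

end PESPInstance

theorem mainTheorem5 {V : Type*} [Fintype V] [DecidableEq V] (I : PESPInstance V)
    (hI : I.Standard) {𝓑 : Type*} [Fintype 𝓑] (Γ : Matrix 𝓑 I.G.Arc ℤ)
    (hΓ : I.G.IsIntegralCycleMatrix Γ) (𝒞 : Set (Set (𝓑 → ℝ)))
    (h𝒞 : IsFineZonotopalTiling (I.scaledCycleMatrix Γ) (I.cycleOffsetZonotope Γ) 𝒞)
    (C : Set (𝓑 → ℝ)) (hC : IsTile 𝒞 C) :
    (∃ S L U : Set I.G.Arc, I.IsSpanningTreeStructure S L U ∧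
      C = I.cycleOffsetMap Γ '' I.boxFace L U) ∧
    (∀ S L U : Set I.G.Arc, I.IsSpanningTreeStructure S L U →
      C = I.cycleOffsetMap Γ '' I.boxFace L U →
      ∀ z : 𝓑 → ℤ, (fun i => (z i : ℝ)) ∈ C → ∃ τ, I.IsVertexDefinedBy Γ z L U τ) := by
  refine ⟨?_, fun S L U hS hCS z hz =>
    PESPInstance.exists_isVertexDefinedBy hI hΓ hS (hCS ▸ hz)⟩
  obtain ⟨L, U, hLU, hCeq, hind, hspan⟩ := h𝒞.exists_eq_faceImage
    (I.cycleOffsetZonotope_eq Γ hI) (PESPInstance.scaledCycleMatrix_col_surjective hI hΓ) hC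
  -- the columns outside of `L ∪ U` form a basis, which makes `L ∪ U` a spanning tree
  refine ⟨L ∪ U, L, U, ⟨rfl, hLU, ?_⟩,
    hCeq.trans (PESPInstance.faceImage_scaledCycleMatrix hI L U)⟩
  have hw : ∀ a, I.u a - I.l a ≠ 0 := fun a => (sub_pos.2 (hI.l_lt_u a)).ne'
  have hT : (I.T : ℝ) ≠ 0 := by exact_mod_cast hI.T_pos.ne'
  refine hΓ.isTree_of_columns hI.connected hI.loopless (fun y hy h0 => ?_) fun c hc => ?_
  · have h1 := hind (fun a => (I.u a - I.l a)⁻¹ * y a) (fun a ha => by simp [hy a ha]) (by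
      rw [PESPInstance.sum_smul_scaledCycleMatrix_col]
      simp only [mul_inv_cancel_left₀ (hw _)]
      rw [h0, smul_zero])
    ext a
    have h2 := congrFun h1 a
    simpa [hw a] using h2
  · classical
    have h1 := hspan (∑ i, (c i : ℝ) • LinearMap.proj i) fun a ha => by
      have h2 : ((∑ i, c i * Γ i a : ℤ) : ℝ) = 0 := by rw [hc a ha, Int.cast_zero]
      have h3 : (∑ i, (c i : ℝ) • LinearMap.proj i : (𝓑 → ℝ) →ₗ[ℝ] ℝ)
          ((I.scaledCycleMatrix Γ).col a) =
          ((∑ i, c i * Γ i a : ℤ) : ℝ) * ((I.u a - I.l a) / I.T) := by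
        simp [LinearMap.sum_apply, PESPInstance.scaledCycleMatrix, Finset.sum_mul, mul_assoc]
      rw [h3, h2, zero_mul]
    ext i
    have h2 := LinearMap.congr_fun h1 (Pi.single i 1)
    simpa [LinearMap.sum_apply, Pi.single_apply] using h2
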